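/- Let $A$ be a Noetherian local normal domain with field of fractions $K$, and let $X$ be a normal connected scheme with a projective, flat and surjective morphism $X \to \operatorname{Spec} A$ (projective meaning that $X$ is isomorphic over $A$ to a closed subscheme of $\mathbb{P}^n_A$ for some $n \ge 0$). Suppose that one of the following conditions holds: 1. $K$ has characteristic $0$ and the generic fiber $X \times_{\operatorname{Spec} A} \operatorname{Spec} K$ is geometrically connected over $K$; 2. the generic fiber $X \times_{\operatorname{Spec} A} \operatorname{Spec} K$ is geometrically integral over $K$. Then there exists a Noetherian graded normal domain $R = \bigoplus_{n \ge 0} R_n$ with $R_0 = A$ such that $R$ is generated as an $R_0$-algebra by $R_1$ and $X \cong \operatorname{Proj} R$ as schemes over $\operatorname{Spec} A$. -/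

import Mathlib

universe u

open AlgebraicGeometry CategoryTheory CategoryTheory.Limits

namespace NormalProj

/-- A scheme is normal if all its local rings are integrally closed domains. -/
class IsNormalScheme (X : Scheme.{u}) : Prop where
  isDomain_stalk (x : X) : IsDomain (X.presheaf.stalk x)
  isIntegrallyClosed_stalk (x : X) : IsIntegrallyClosed (X.presheaf.stalk x)

/-- The structure morphism `Proj R ⟶ Spec R₀ ⟶ Spec A` of a graded `A`-algebra `R`. -/
noncomputable def projToSpec (A : Type u) {R : Type u} [CommRing A] [CommRing R] [Algebra A R]
    (𝒜 : ℕ → Submodule A R) [GradedAlgebra 𝒜] : Proj 𝒜 ⟶ Spec (CommRingCat.of A) :=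
  Proj.toSpecZero 𝒜 ≫ Spec.map (CommRingCat.ofHom (algebraMap A (𝒜 0)))

section

attribute [local instance] MvPolynomial.gradedAlgebra

/-- Projective `n`-space `Proj A[X₀, …, Xₙ]` over `A`, for the grading by total degree. -/
noncomputable def projectiveSpace (A : Type u) [CommRing A] (n : ℕ) : Scheme.{u} :=
  Proj (MvPolynomial.homogeneousSubmodule (Fin (n + 1)) A)

/-- The structure morphism of projective `n`-space. -/
noncomputable def projectiveSpaceToSpec (A : Type u) [CommRing A] (n : ℕ) :
    projectiveSpace A n ⟶ Spec (CommRingCat.of A) :=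
  projToSpec A (MvPolynomial.homogeneousSubmodule (Fin (n + 1)) A)

end

/-- `f : X ⟶ Spec A` is projective if `X` is isomorphic over `A` to a closed subscheme of some
projective space `ℙⁿ_A`. -/
class IsProjectiveOver {A : Type u} [CommRing A] {X : Scheme.{u}}
    (f : X ⟶ Spec (CommRingCat.of A)) : Prop where
  exists_closedImmersion : ∃ (n : ℕ) (i : X ⟶ projectiveSpace A n),
    IsClosedImmersion i ∧ i ≫ projectiveSpaceToSpec A n = f

/-- The generic fiber `X ×_A Frac A ⟶ Spec (Frac A)` of a scheme over a domain `A`, as a morphism. -/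
noncomputable def genericFiberToSpec {A : Type u} [CommRing A] [IsDomain A] {X : Scheme.{u}}
    (f : X ⟶ Spec (CommRingCat.of A)) :
    pullback f (Spec.map (CommRingCat.ofHom (algebraMap A (FractionRing A)))) ⟶
      Spec (CommRingCat.of (FractionRing A)) :=
  pullback.snd f (Spec.map (CommRingCat.ofHom (algebraMap A (FractionRing A))))

/-- The condition `(St)` on an `ℕ`-graded ring `R`: it is Noetherian, it is generated by `R₁` over
`R₀`, and `R₀` is a Noetherian ring with a unique maximal ideal. -/
structure IsStandardGraded {A R : Type u} [CommRing A] [CommRing R] [Algebra A R]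
    (𝒜 : ℕ → Submodule A R) [GradedAlgebra 𝒜] : Prop where
  isNoetherianRing : IsNoetherianRing R
  isNoetherianRing_zero : IsNoetherianRing (𝒜 0)
  isLocalRing_zero : IsLocalRing (𝒜 0)
  adjoin_one : Algebra.adjoin (𝒜 0) (𝒜 1 : Set R) = ⊤

end NormalProj

/-!
Since `X` is Noetherian, normal and connected it is integral (`isIntegral_of_isNormalScheme`); let
`F` be its function field. Choosing a standard chart of `ℙⁿ` that contains the generic point, the
coordinates of `ℙⁿ` become elements `c₀, …, cₙ` of `F`, one of them equal to `1`
(`exists_coordinates`). Put `V = ∑ A cⱼ ⊆ F`. For `cⱼ ≠ 0` the open set `Uⱼ = X ∩ D₊(xⱼ)` is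
affine with coordinate ring `Aⱼ = ⋃ₖ Vᵏ / cⱼᵏ ⊆ F`, because a closed immersion is surjective on
coordinate rings; the other `Uⱼ` are empty. All that follows takes place inside `F`, and the ring
of the theorem is the Rees algebra `R = ⨁ₖ V^(dk) Xᵏ ⊆ F[X]` of a suitable power of `V`, that is,
the homogeneous coordinate ring of a Veronese embedding of `X`.

* For every `d > 0`, `Proj R` has the charts `Spec Aⱼ`, glued along the same point `Spec F`, so it
  is isomorphic to `X` (`exists_iso_proj_reesGrading`): both schemes are separated, and morphisms
  from a reduced scheme to a separated one are determined on a dominant point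
  (`exists_iso_of_charts`).
* The degree zero part of `R` is `A` and `R` is generated in degree one by construction. It is
  Noetherian because `V` is finitely generated.
* For normality, each `Aⱼ` is integrally closed in `F` since `X` is normal, so the coefficient in
  degree `k` of an element of `F[X]` integral over `R` lies in `⋂ⱼ cⱼ^(dk) Aⱼ`
  (`coeff_mem_of_isIntegral_reesSubalgebra`). It remains to see that this intersection, the space
  `H⁰(X, 𝒪(dk))`, is `V^(dk)`. For large degrees this follows from the Noetherian property of the
  Rees algebra of `V` (`exists_forall_mem_pow_of_mul_le`), so some `d` works for all `k > 0`. In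
  degree zero it says that `Γ(X, 𝒪) = A`.
* A global section multiplies some power of `V` into itself, hence it is integral over `A`
  (`isIntegral_of_forall_mem_chartAlgebra`). Its minimal polynomial over the normal domain `A`
  stays irreducible over `K = Frac A` and defines a finite extension `M` of `K` such that the
  generic fibre is a scheme over `M`. Its base change to `M` then lies over `M ⊗ M`, and geometric
  integrality, or geometric connectedness with `M` separable over `K`, forces `M = K`
  (`finrank_eq_one_of_geometrically`). So the section comes from `A`
  (`exists_structureHom_eq_of_isIntegralElem`).
-/

namespace NormalProj

/-! ### The Rees algebra of a submodule of a field -/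

section ReesSubalgebra

open Polynomial

variable {A F : Type*} [CommRing A] [Field F] [Algebra A F]

/-- The Rees algebra `⨁ Wᵏ Xᵏ` of an `A`-submodule `W` of a field `F`, as a subalgebra of `F[X]`. -/
def reesSubalgebra (W : Submodule A F) : Subalgebra A F[X] where
  carrier := {h | ∀ k, h.coeff k ∈ W ^ k}
  mul_mem' hf hg i := by
    rw [coeff_mul]
    refine Submodule.sum_mem _ fun jk e ↦ ?_
    rw [← Finset.HasAntidiagonal.mem_antidiagonal.mp e, pow_add]
    exact Submodule.mul_mem_mul (hf _) (hg _)
  add_mem' hf hg i := by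
    rw [coeff_add]
    exact add_mem (hf i) (hg i)
  algebraMap_mem' r i := by
    rw [Polynomial.algebraMap_apply, coeff_C]
    split_ifs with h
    · subst h
      rw [pow_zero]
      exact Submodule.algebraMap_mem r
    · exact zero_mem _

theorem monomial_mem_reesSubalgebra {W : Submodule A F} {k : ℕ} {w : F} (hw : w ∈ W ^ k) :
    monomial k w ∈ reesSubalgebra W := by
  intro j
  rw [coeff_monomial]
  split_ifs with h
  · exact h ▸ hw
  · exact zero_mem _

theorem monomial_mem_adjoin {W : Submodule A F} {s : Set F} (hs : Submodule.span A s = W) {k : ℕ}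
    {w : F} (hw : w ∈ W ^ k) : monomial k w ∈ Algebra.adjoin A (monomial 1 '' s : Set F[X]) := by
  induction k generalizing w with
  | zero =>
    rw [pow_zero, Submodule.mem_one] at hw
    obtain ⟨a, rfl⟩ := hw
    exact Subalgebra.algebraMap_mem _ a
  | succ k ih =>
    rw [pow_succ'] at hw
    refine Submodule.mul_induction_on hw (fun m hm n hn ↦ ?_) fun x y hx hy ↦ ?_
    · rw [add_comm k 1, ← monomial_mul_monomial]
      refine Subalgebra.mul_mem _ ?_ (ih hn)
      rw [← hs] at hm
      induction hm using Submodule.span_induction with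
      | mem x h => exact Algebra.subset_adjoin (Set.mem_image_of_mem _ h)
      | zero => rw [map_zero]; exact zero_mem _
      | add x y _ _ hx hy => rw [map_add]; exact add_mem hx hy
      | smul a x _ hx => rw [← smul_monomial]; exact Subalgebra.smul_mem _ hx a
    · rw [map_add]
      exact add_mem hx hy

theorem adjoin_monomial_eq_reesSubalgebra {W : Submodule A F} {s : Set F}
    (hs : Submodule.span A s = W) :
    Algebra.adjoin A (monomial 1 '' s : Set F[X]) = reesSubalgebra W := by
  apply le_antisymm
  · refine Algebra.adjoin_le ?_
    rintro _ ⟨r, hr, rfl⟩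
    exact monomial_mem_reesSubalgebra (by rw [pow_one, ← hs]; exact Submodule.subset_span hr)
  · intro p hp
    rw [p.as_sum_support]
    exact Subalgebra.sum_mem _ fun i _ ↦ monomial_mem_adjoin hs (hp i)

theorem isNoetherianRing_reesSubalgebra [IsNoetherianRing A] {W : Submodule A F} (hW : W.FG) :
    IsNoetherianRing (reesSubalgebra W) := by
  classical
  obtain ⟨s, hs⟩ := hW
  have : (reesSubalgebra W).FG :=
    ⟨s.image (monomial 1), by rw [Finset.coe_image, adjoin_monomial_eq_reesSubalgebra hs]⟩
  have : Algebra.FiniteType A (reesSubalgebra W) := ⟨(reesSubalgebra W).fg_top.mpr this⟩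
  exact Algebra.FiniteType.isNoetherianRing A _

/-- The degree `k` part `Wᵏ Xᵏ` of the Rees algebra. -/
def reesGrading (W : Submodule A F) (k : ℕ) : Submodule A (reesSubalgebra W) where
  carrier := {h | ∀ j, j ≠ k → (h : F[X]).coeff j = 0}
  add_mem' hf hg j hj := by simp [hf j hj, hg j hj]
  zero_mem' j _ := by simp
  smul_mem' a h hh j hj := by simp [hh j hj]

theorem mem_reesGrading {W : Submodule A F} {k : ℕ} {h : reesSubalgebra W} :
    h ∈ reesGrading W k ↔ (h : F[X]) = monomial k ((h : F[X]).coeff k) := by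
  constructor
  · intro hh
    ext j
    rw [coeff_monomial]
    split_ifs with hj
    · rw [hj]
    · exact hh j (Ne.symm hj)
  · intro hh j hj
    rw [hh, coeff_monomial, if_neg (Ne.symm hj)]

/-- The element `w Xᵏ` of degree `k` of the Rees algebra. -/
noncomputable def reesMonomial (W : Submodule A F) (k : ℕ) (w : F) (hw : w ∈ W ^ k) :
    reesSubalgebra W :=
  ⟨monomial k w, monomial_mem_reesSubalgebra hw⟩

theorem reesMonomial_mem {W : Submodule A F} {k : ℕ} {w : F} (hw : w ∈ W ^ k) :
    reesMonomial W k w hw ∈ reesGrading W k := by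
  rw [mem_reesGrading]
  simp [reesMonomial]

theorem exists_eq_reesMonomial {W : Submodule A F} {k : ℕ} {h : reesSubalgebra W}
    (hh : h ∈ reesGrading W k) : ∃ w hw, h = reesMonomial W k w hw :=
  ⟨_, h.2 k, Subtype.ext (mem_reesGrading.mp hh)⟩

instance (W : Submodule A F) : SetLike.GradedMonoid (reesGrading W) where
  one_mem j hj := by
    rw [OneMemClass.coe_one, coeff_one, if_neg hj]
  mul_mem i j x y hx hy := by
    rw [mem_reesGrading, MulMemClass.coe_mul, mem_reesGrading.mp hx, mem_reesGrading.mp hy,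
      monomial_mul_monomial, coeff_monomial, if_pos rfl]

/-- The projection of the Rees algebra onto its degree `k` part. -/
noncomputable def reesComponent (W : Submodule A F) (k : ℕ) :
    reesSubalgebra W →ₗ[A] reesGrading W k where
  toFun h := ⟨reesMonomial W k _ (h.2 k), reesMonomial_mem _⟩
  map_add' _ _ := Subtype.ext (Subtype.ext (map_add (monomial k) _ _))
  map_smul' a _ := Subtype.ext (Subtype.ext (smul_monomial a k _).symm)

theorem reesComponent_of_mem {W : Submodule A F} (i j : ℕ) (x : reesGrading W i) :
    reesComponent W j (x : reesSubalgebra W) =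
      (DirectSum.of (fun k ↦ reesGrading W k) i x) j := by
  obtain rfl | hij := eq_or_ne i j
  · rw [DirectSum.of_eq_same]
    ext1
    exact Subtype.ext (mem_reesGrading.mp x.2).symm
  · rw [DirectSum.of_eq_of_ne _ _ _ hij.symm]
    ext1
    refine Subtype.ext ?_
    change monomial j (((x : reesSubalgebra W) : F[X]).coeff j) = 0
    rw [x.2 j hij.symm, map_zero]

noncomputable instance reesGradedAlgebra (W : Submodule A F) : GradedAlgebra (reesGrading W) where
  decompose' h := ∑ k ∈ (h : F[X]).support, DirectSum.of _ k (reesComponent W k h)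
  left_inv h := by
    rw [map_sum]
    ext1
    simp only [DirectSum.coeAddMonoidHom_of]
    conv_rhs => rw [(h : F[X]).as_sum_support]
    rw [AddSubmonoidClass.coe_finsetSum]
    rfl
  right_inv x := by
    have h1 : ∀ (h : reesSubalgebra W) (j : ℕ), (∑ k ∈ (h : F[X]).support,
        DirectSum.of (fun k ↦ reesGrading W k) k (reesComponent W k h)) j =
          reesComponent W j h := by
      intro h j
      rw [DFinsupp.finsetSum_apply, Finset.sum_eq_single j]
      · exact DirectSum.of_eq_same _ _
      · intro k _ hk
        exact DirectSum.of_eq_of_ne _ _ _ hk.symm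
      · intro hj
        have : reesComponent W j h = 0 := by
          ext1
          refine Subtype.ext ?_
          change monomial j ((h : F[X]).coeff j) = 0
          rw [notMem_support_iff.mp hj, map_zero]
        rw [this, map_zero]
        rfl
    refine DFinsupp.ext fun j ↦ ?_
    rw [h1]
    induction x using DirectSum.induction_on with
    | zero => rw [map_zero, map_zero]; rfl
    | of i x => rw [DirectSum.coeAddMonoidHom_of]; exact reesComponent_of_mem i j x
    | add x y hx hy => rw [map_add, map_add, hx, hy]; rfl

end ReesSubalgebra

/-! ### Sections of high powers over all charts -/

section Stability

open Polynomial

variable {A F : Type*} [CommRing A] [Field F] [Algebra A F]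

/-- The elements `g` such that `V^(N+1) g ⊆ V^(N+k)` for some `N`. -/
def saturation (V : Submodule A F) (k : ℕ) : Submodule A F where
  carrier := {g | ∃ N, V ^ (N + 1) * Submodule.span A {g} ≤ V ^ (N + k)}
  add_mem' := by
    rintro g h ⟨N, hN⟩ ⟨M, hM⟩
    refine ⟨N + M, ?_⟩
    have : Submodule.span A {g + h} ≤ Submodule.span A {g} ⊔ Submodule.span A {h} := by
      rw [Submodule.span_singleton_le_iff_mem]
      exact add_mem (Submodule.mem_sup_left (Submodule.mem_span_singleton_self g))
        (Submodule.mem_sup_right (Submodule.mem_span_singleton_self h))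
    refine (mul_le_mul_right this _).trans ?_
    rw [Submodule.mul_sup]
    refine sup_le ?_ ?_
    · rw [show N + M + 1 = M + (N + 1) by ring, show N + M + k = M + (N + k) by ring,
        pow_add, pow_add V M, mul_assoc]
      exact mul_le_mul_right hN _
    · rw [show N + M + 1 = N + (M + 1) by ring, show N + M + k = N + (M + k) by ring,
        pow_add, pow_add V N, mul_assoc]
      exact mul_le_mul_right hM _
  zero_mem' := ⟨0, by simp⟩
  smul_mem' := by
    rintro a g ⟨N, hN⟩
    refine ⟨N, (mul_le_mul_right ?_ _).trans hN⟩
    rw [Submodule.span_singleton_le_iff_mem]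
    exact Submodule.smul_mem _ _ (Submodule.mem_span_singleton_self g)

theorem mul_mem_saturation {V : Submodule A F} {i k : ℕ} {v g : F} (hv : v ∈ V ^ i)
    (hg : g ∈ saturation V k) : v * g ∈ saturation V (i + k) := by
  obtain ⟨N, hN⟩ := hg
  refine ⟨N, ?_⟩
  calc V ^ (N + 1) * Submodule.span A {v * g}
      ≤ V ^ (N + 1) * (V ^ i * Submodule.span A {g}) := by
        refine mul_le_mul_right ?_ _
        rw [Submodule.span_singleton_le_iff_mem]
        exact Submodule.mul_mem_mul hv (Submodule.mem_span_singleton_self g)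
    _ = V ^ i * (V ^ (N + 1) * Submodule.span A {g}) := mul_left_comm _ _ _
    _ ≤ V ^ i * V ^ (N + k) := mul_le_mul_right hN _
    _ = V ^ (N + (i + k)) := by rw [← pow_add]; congr 1; ring

/-- The ideal of the Rees algebra whose degree `k` part consists of the `g ∈ Vᵏ` in
`saturation V k`. -/
def saturationIdeal (V : Submodule A F) : Ideal (reesSubalgebra V) where
  carrier := {h | ∀ k, (h : F[X]).coeff k ∈ saturation V k}
  add_mem' hf hg k := by
    rw [AddMemClass.coe_add, coeff_add]
    exact add_mem (hf k) (hg k)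
  zero_mem' k := by simp
  smul_mem' s h hh k := by
    rw [smul_eq_mul, MulMemClass.coe_mul, coeff_mul]
    refine Submodule.sum_mem _ fun jk e ↦ ?_
    rw [← Finset.HasAntidiagonal.mem_antidiagonal.mp e]
    exact mul_mem_saturation (s.2 _) (hh _)

/-- In large degrees, an element of `V^(m+1)` multiplying some `V^(N+1)` into `V^(N+m+1)` lies in
`Vᵐ`: the Rees algebra is Noetherian, so finitely many generators of `saturationIdeal V` bound the
exponents `N` needed. -/
theorem exists_forall_mem_pow_of_mem_saturation [IsNoetherianRing A] {V : Submodule A F}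
    (hV : V.FG) : ∃ m₀, ∀ m ≥ m₀, ∀ g ∈ V ^ (m + 1), g ∈ saturation V (m + 1) → g ∈ V ^ m := by
  have := isNoetherianRing_reesSubalgebra hV
  obtain ⟨t, ht⟩ := (isNoetherianRing_iff_ideal_fg _).mp this (saturationIdeal V)
  have hmono : ∀ {g : F} {k N M : ℕ}, N ≤ M → V ^ (N + 1) * Submodule.span A {g} ≤ V ^ (N + k) →
      V ^ (M + 1) * Submodule.span A {g} ≤ V ^ (M + k) := by
    intro g k N M hNM h
    obtain ⟨c, rfl⟩ := Nat.exists_eq_add_of_le' hNM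
    rw [add_assoc, add_assoc, pow_add, pow_add V c (N + k), mul_assoc]
    exact mul_le_mul_right h _
  have h1 : ∀ h ∈ t, ∀ k, ∃ N,
      V ^ (N + 1) * Submodule.span A {(h : F[X]).coeff k} ≤ V ^ (N + k) := by
    intro h hh
    have : h ∈ saturationIdeal V := ht ▸ Submodule.subset_span hh
    exact this
  choose! N hN using h1
  -- a common bound for the degrees of the generators and for the exponents `N`
  let D := t.sup fun h ↦ (h : F[X]).natDegree
  let M := t.sup fun h ↦ (Finset.range (D + 1)).sup (N h)
  refine ⟨M + D, fun m hm g hg hgs ↦ ?_⟩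
  have hmem : reesMonomial V (m + 1) g hg ∈ saturationIdeal V := by
    intro k
    change (monomial (m + 1) g).coeff k ∈ _
    rw [coeff_monomial]
    split_ifs with h
    · exact h ▸ hgs
    · exact zero_mem _
  rw [← ht, Submodule.mem_span_finset] at hmem
  obtain ⟨f, -, hf⟩ := hmem
  have hg' : g = ((∑ a ∈ t, f a • a : reesSubalgebra V) : F[X]).coeff (m + 1) := by
    rw [hf]
    simp [reesMonomial]
  rw [hg', AddSubmonoidClass.coe_finsetSum, finsetSum_coeff]
  refine Submodule.sum_mem _ fun h hh ↦ ?_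
  rw [smul_eq_mul, MulMemClass.coe_mul, coeff_mul]
  refine Submodule.sum_mem _ fun ij e ↦ ?_
  have hij := Finset.HasAntidiagonal.mem_antidiagonal.mp e
  by_cases hj : D < ij.2
  · rw [coeff_eq_zero_of_natDegree_lt ((Finset.le_sup (f := fun h : reesSubalgebra V ↦
      (h : F[X]).natDegree) hh).trans_lt hj), mul_zero]
    exact zero_mem _
  · have hNM : N h ij.2 ≤ M := (Finset.le_sup (f := N h) (Finset.mem_range.mpr (by lia))).trans
      (Finset.le_sup (f := fun h ↦ (Finset.range (D + 1)).sup (N h)) hh)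
    obtain ⟨c, hc⟩ : ∃ c, ij.1 = c + (M + 1) := Nat.exists_eq_add_of_le' (by lia)
    have h2 : V ^ ij.1 * Submodule.span A {(h : F[X]).coeff ij.2} ≤ V ^ m := by
      rw [hc, show m = c + (M + ij.2) by lia, pow_add, pow_add V c, mul_assoc]
      exact mul_le_mul_right (hmono hNM (hN h hh _)) _
    exact h2 (Submodule.mul_mem_mul ((f h).2 _) (Submodule.mem_span_singleton_self _))

theorem pow_le_pow_of_one_mem {V : Submodule A F} (h1 : (1 : F) ∈ V) {m n : ℕ} (h : m ≤ n) :
    V ^ m ≤ V ^ n :=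
  pow_le_pow_right₀ (Submodule.one_le.mpr h1) h

/-- For large `m`, every `g` with `V^N g ⊆ V^(N+m)` for some `N` lies in `Vᵐ`. Since `1 ∈ V`, such a
`g` lies in some `V^(m+j)`, and the exponent is lowered one step at a time. -/
theorem exists_forall_mem_pow_of_mul_le [IsNoetherianRing A] {V : Submodule A F}
    (hV : V.FG) (h1 : (1 : F) ∈ V) : ∃ m₀, ∀ m ≥ m₀, ∀ g : F,
      (∃ N, V ^ N * Submodule.span A {g} ≤ V ^ (N + m)) → g ∈ V ^ m := by
  obtain ⟨m₀, h₀⟩ := exists_forall_mem_pow_of_mem_saturation hV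
  refine ⟨m₀, fun m hm g ⟨N, hN⟩ ↦ ?_⟩
  have hg : g ∈ V ^ (m + N) := by
    rw [add_comm]
    refine hN ?_
    have h1N : (1 : F) ∈ V ^ N := one_pow (M := F) N ▸ Submodule.pow_mem_pow V h1 N
    simpa using Submodule.mul_mem_mul h1N (Submodule.mem_span_singleton_self (R := A) g)
  have key : ∀ j, g ∈ V ^ (m + j) → g ∈ V ^ m := by
    intro j
    induction j with
    | zero => exact id
    | succ j ih =>
      refine fun hj ↦ ih (h₀ (m + j) (by lia) g hj ⟨N, ?_⟩)
      rw [pow_succ', mul_assoc]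
      refine (mul_le_mul_right hN _).trans ?_
      rw [← pow_succ']
      exact pow_le_pow_of_one_mem h1 (by lia)
  exact key N hg

/-- If every generator `fᵢ` of `V` has a power multiplying `g` into the expected power of `V`, then
so does `V` itself. -/
theorem exists_mul_le_of_forall_generators {ι : Type*} [Finite ι] (f : ι → F) {m : ℕ} {g : F}
    {V : Submodule A F} (hV : Submodule.span A (Set.range f) = V)
    (h : ∀ i, ∃ N, f i ^ N * g ∈ V ^ (N + m)) :
    ∃ N, V ^ N * Submodule.span A {g} ≤ V ^ (N + m) := by
  have hf (i) : f i ∈ V ^ 1 := by rw [pow_one, ← hV]; exact Submodule.subset_span ⟨i, rfl⟩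
  let I : Ideal (reesSubalgebra V) :=
  { carrier := {s | ∀ k, (s : F[X]).coeff k * g ∈ V ^ (k + m)}
    add_mem' := fun ha hb k ↦ by
      rw [AddMemClass.coe_add, coeff_add, add_mul]
      exact add_mem (ha k) (hb k)
    zero_mem' := fun k ↦ by simp
    smul_mem' := fun s a ha k ↦ by
      rw [smul_eq_mul, MulMemClass.coe_mul, coeff_mul, Finset.sum_mul]
      refine Submodule.sum_mem _ fun jk e ↦ ?_
      rw [← Finset.HasAntidiagonal.mem_antidiagonal.mp e, add_assoc, pow_add, mul_assoc]
      exact Submodule.mul_mem_mul (s.2 _) (ha _) }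
  let J : Ideal (reesSubalgebra V) := Ideal.span (Set.range fun i ↦ reesMonomial V 1 (f i) (hf i))
  have hJI : J ≤ I.radical := by
    rw [Ideal.span_le]
    rintro _ ⟨i, rfl⟩
    obtain ⟨N, hN⟩ := h i
    refine ⟨N, fun k ↦ ?_⟩
    simp only [reesMonomial, SubmonoidClass.mk_pow, monomial_pow, one_mul, coeff_monomial]
    split_ifs with hk
    · exact hk ▸ hN
    · simp
  have hJ : J.FG := Submodule.fg_span (Set.finite_range _)
  obtain ⟨N, hN⟩ := Ideal.exists_pow_le_of_le_radical_of_fg hJI hJ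
  have hVJ : ∀ v (hv : v ∈ V ^ 1), reesMonomial V 1 v hv ∈ J := by
    intro v hv
    have hv' := hv
    rw [pow_one, ← hV] at hv'
    induction hv' using Submodule.span_induction with
    | mem x h => obtain ⟨i, rfl⟩ := h; exact Ideal.subset_span ⟨i, rfl⟩
    | zero =>
      convert zero_mem J
      exact Subtype.ext (map_zero (monomial 1))
    | add x y hx hy ihx ihy =>
      rw [hV, ← pow_one V] at hx hy
      convert add_mem (ihx hx) (ihy hy)
      exact Subtype.ext (map_add (monomial 1) _ _)
    | smul a x hx ihx =>
      rw [hV, ← pow_one V] at hx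
      convert J.smul_of_tower_mem a (ihx hx)
      exact Subtype.ext (smul_monomial a 1 _).symm
  have hVJN : ∀ n v (hv : v ∈ V ^ n), reesMonomial V n v hv ∈ J ^ n := by
    intro n
    induction n with
    | zero => intro v hv; simp
    | succ n ih =>
      intro v hv
      have hv' := hv
      rw [pow_succ'] at hv'
      induction hv' using Submodule.mul_induction_on' with
      | mem_mul_mem x hx y hy =>
        rw [← pow_one V] at hx
        rw [pow_succ']
        convert Ideal.mul_mem_mul (hVJ x hx) (ih y hy)
        refine Subtype.ext ?_
        simp [reesMonomial, monomial_mul_monomial, add_comm]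
      | add x hx y hy ihx ihy =>
        rw [← pow_succ'] at hx hy
        convert add_mem (ihx hx) (ihy hy)
        exact Subtype.ext (map_add (monomial _) _ _)
  refine ⟨N, ?_⟩
  rw [Submodule.mul_le]
  intro v hv y hy
  obtain ⟨a, rfl⟩ := Submodule.mem_span_singleton.mp hy
  rw [mul_smul_comm]
  refine Submodule.smul_mem _ _ ?_
  simpa [reesMonomial] using hN (hVJN N v hv) N

end Stability

/-! ### Chart algebras and normality of the Rees algebra -/

section Charts

open Polynomial

variable {A F : Type u} [CommRing A] [Field F] [Algebra A F]

/-- For `f ∈ V`, the algebra `⋃ₖ Vᵏ / fᵏ`, consisting of the `g` with `fᵏ g ∈ Vᵏ` for some `k`. -/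
def chartAlgebra (V : Submodule A F) (f : F) (hf : f ∈ V) : Subalgebra A F where
  carrier := {g | ∃ k, f ^ k * g ∈ V ^ k}
  mul_mem' := by
    rintro g h ⟨k, hk⟩ ⟨l, hl⟩
    refine ⟨k + l, ?_⟩
    rw [pow_add, pow_add, mul_mul_mul_comm]
    exact Submodule.mul_mem_mul hk hl
  add_mem' := by
    rintro g h ⟨k, hk⟩ ⟨l, hl⟩
    refine ⟨k + l, ?_⟩
    rw [mul_add]
    refine add_mem ?_ ?_
    · rw [add_comm, pow_add, pow_add, mul_assoc]
      exact Submodule.mul_mem_mul (Submodule.pow_mem_pow V hf l) hk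
    · rw [pow_add, pow_add, mul_assoc]
      exact Submodule.mul_mem_mul (Submodule.pow_mem_pow V hf k) hl
  algebraMap_mem' r := ⟨0, by simp⟩

theorem mem_chartAlgebra {V : Submodule A F} {f : F} {hf : f ∈ V} {g : F} :
    g ∈ chartAlgebra V f hf ↔ ∃ k, f ^ k * g ∈ V ^ k := Iff.rfl

theorem mem_chartAlgebra_pow {V : Submodule A F} {f : F} {hf : f ∈ V} {g : F} {d : ℕ} (hd : 0 < d) :
    g ∈ chartAlgebra (V ^ d) (f ^ d) (Submodule.pow_mem_pow V hf d) ↔ g ∈ chartAlgebra V f hf := by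
  simp only [mem_chartAlgebra, ← pow_mul]
  refine ⟨fun ⟨k, hk⟩ ↦ ⟨_, hk⟩, fun ⟨k, hk⟩ ↦ ⟨k, ?_⟩⟩
  obtain ⟨c, hc⟩ : ∃ c, d * k = c + k := Nat.exists_eq_add_of_le' (Nat.le_mul_of_pos_left k hd)
  rw [hc, pow_add, pow_add, mul_assoc]
  exact Submodule.mul_mem_mul (Submodule.pow_mem_pow V hf c) hk

/-- The global sections of high powers: if `g ∈ fᵢᵐ Aᵢ` on every chart, then `g ∈ Vᵐ`, provided
`m` is large, or `m = 0` and the charts have no common element outside `A`. -/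
theorem exists_pos_forall_mem_pow [IsNoetherianRing A] {ι : Type*} [Finite ι] {f : ι → F}
    {V : Submodule A F} (hV : Submodule.span A (Set.range f) = V) (hf : ∀ i, f i ∈ V) (h1 : 1 ∈ V)
    (h0 : ∀ g : F, (∀ i, f i ≠ 0 → g ∈ chartAlgebra V (f i) (hf i)) → g ∈ (1 : Submodule A F)) :
    ∃ d, 0 < d ∧ ∀ k g, (∀ i, f i ≠ 0 → ∃ a ∈ chartAlgebra V (f i) (hf i), g = f i ^ (d * k) * a) →
      g ∈ V ^ (d * k) := by
  have hfg : V.FG := hV ▸ Submodule.fg_span (Set.finite_range f)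
  obtain ⟨m₀, h⟩ := exists_forall_mem_pow_of_mul_le hfg h1
  refine ⟨m₀ + 1, Nat.succ_pos _, fun k g hg ↦ ?_⟩
  obtain rfl | hk := Nat.eq_zero_or_pos k
  · rw [mul_zero, pow_zero]
    refine h0 g fun i hi ↦ ?_
    obtain ⟨a, ha, rfl⟩ := hg i hi
    simpa using ha
  · refine h _ ((Nat.le_succ _).trans (Nat.le_mul_of_pos_right _ hk)) g
      (exists_mul_le_of_forall_generators f hV fun i ↦ ?_)
    by_cases hi : f i = 0
    · exact ⟨1, by simp [hi]⟩
    · obtain ⟨a, ⟨N, hN⟩, rfl⟩ := hg i hi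
      refine ⟨N, ?_⟩
      rw [mul_left_comm, add_comm, pow_add]
      exact Submodule.mul_mem_mul (Submodule.pow_mem_pow V (hf i) _) hN

/-- An element in all charts is integral over `A`. -/
theorem isIntegral_of_forall_mem_chartAlgebra [IsNoetherianRing A] {ι : Type*} [Finite ι]
    {f : ι → F} {V : Submodule A F} (hV : Submodule.span A (Set.range f) = V)
    (hf : ∀ i, f i ∈ V) (h1 : 1 ∈ V) {g : F} (hg : ∀ i, f i ≠ 0 → g ∈ chartAlgebra V (f i) (hf i)) :
    IsIntegral A g := by
  have hfg : V.FG := hV ▸ Submodule.fg_span (Set.finite_range f)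
  obtain ⟨N, hN⟩ := exists_mul_le_of_forall_generators (m := 0) (g := g) f hV fun i ↦ by
    by_cases hi : f i = 0
    · exact ⟨1, by simp [hi]⟩
    · exact hg i hi
  have h1N : (1 : F) ∈ V ^ N := one_pow (M := F) N ▸ Submodule.pow_mem_pow V h1 N
  refine isIntegral_of_smul_mem_submodule (M := F) (N := V ^ N) ?_ (hfg.pow N) g fun n hn ↦ ?_
  · exact fun h ↦ one_ne_zero ((Submodule.mem_bot A).mp (h ▸ h1N))
  · rw [smul_eq_mul, mul_comm]
    exact hN (Submodule.mul_mem_mul hn (Submodule.mem_span_singleton_self g))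

/-- The coefficients of an element of `F[X]` integral over the Rees algebra of `W` lie in the
expected multiple of every chart algebra integrally closed in `F`. -/
theorem coeff_mem_of_isIntegral_reesSubalgebra {W : Submodule A F} {f : F} (hf : f ∈ W)
    (hf0 : f ≠ 0) (hn : ∀ g : F, IsIntegral (chartAlgebra W f hf) g → g ∈ chartAlgebra W f hf)
    {x : F[X]} (hx : IsIntegral (reesSubalgebra W) x) (k : ℕ) :
    ∃ a ∈ chartAlgebra W f hf, x.coeff k = f ^ k * a := by
  set B := chartAlgebra W f hf
  -- rescaling the variable by `f⁻¹` carries the Rees algebra into `B[X]`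
  let σ : F[X] →+* F[X] := compRingHom (C f⁻¹ * X)
  have hσ (p : F[X]) (k : ℕ) : (σ p).coeff k = p.coeff k * f⁻¹ ^ k := comp_C_mul_X_coeff
  let j : B[X] →+* F[X] := mapRingHom (algebraMap B F)
  have hj : Function.Injective j := map_injective _ Subtype.val_injective
  have hmem : ∀ s : reesSubalgebra W, σ s ∈ j.range := by
    intro s
    have : σ s ∈ lifts (algebraMap B F) := by
      rw [lifts_iff_coeff_lifts]
      intro k
      refine ⟨⟨_, k, ?_⟩, rfl⟩
      change f ^ k * (σ s).coeff k ∈ W ^ k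
      rw [hσ, mul_comm, mul_assoc, ← mul_pow, inv_mul_cancel₀ hf0, one_pow, mul_one]
      exact s.2 k
    exact this
  let e : B[X] ≃+* j.range := RingEquiv.ofBijective j.rangeRestrict
    ⟨fun a b h ↦ hj congr(($h).1), j.rangeRestrict_surjective⟩
  let φ : reesSubalgebra W →+* B[X] := e.symm.toRingHom.comp
    ((σ.comp (algebraMap (reesSubalgebra W) F[X])).codRestrict j.range hmem)
  let := Polynomial.algebra B F
  have hint : _root_.IsIntegral B[X] (σ x) := by
    refine hx.map_of_comp_eq φ σ ?_
    ext s : 1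
    change ((e (e.symm _) : j.range) : F[X]) = _
    rw [e.apply_symm_apply]
    rfl
  have := hn _ (hint.coeff k)
  refine ⟨_, this, ?_⟩
  rw [hσ, mul_left_comm, ← mul_pow, mul_inv_cancel₀ hf0, one_pow, mul_one]

/-- The Rees algebra of `W` is normal if its chart algebras are integrally closed in `F` and each
`Wᵏ` consists of all the elements lying in `fᵢᵏ Aᵢ` on every chart. -/
theorem isIntegrallyClosed_reesSubalgebra {W : Submodule A F} {ι : Type*} (f : ι → F)
    (hf : ∀ i, f i ∈ W) (hf0 : ∀ i, f i ≠ 0)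
    (hn : ∀ i, ∀ g : F, IsIntegral (chartAlgebra W (f i) (hf i)) g →
      g ∈ chartAlgebra W (f i) (hf i))
    (hW : ∀ k g, (∀ i, ∃ a ∈ chartAlgebra W (f i) (hf i), g = f i ^ k * a) → g ∈ W ^ k) :
    IsIntegrallyClosed (reesSubalgebra W) := by
  have : IsIntegrallyClosed F[X] := UniqueFactorizationMonoid.instIsIntegrallyClosed
  suffices IsIntegrallyClosedIn (reesSubalgebra W) F[X] from
    .of_isIntegrallyClosed_of_isIntegrallyClosedIn _ F[X]
  refine isIntegrallyClosedIn_iff.mpr ⟨Subtype.val_injective, fun {x} hx ↦ ?_⟩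
  exact ⟨⟨x, fun k ↦ hW k _ fun i ↦
    coeff_mem_of_isIntegral_reesSubalgebra (hf i) (hf0 i) (hn i) hx k⟩, rfl⟩

theorem bijective_algebraMap_reesGrading_zero (hA : Function.Injective (algebraMap A F))
    (W : Submodule A F) : Function.Bijective (algebraMap A (reesGrading W 0)) := by
  constructor
  · intro a b h
    have : C (algebraMap A F a) = C (algebraMap A F b) := congr((($h : reesGrading W 0) : F[X]))
    exact hA (C_injective this)
  · rintro ⟨x, hx⟩
    obtain ⟨w, hw, rfl⟩ := exists_eq_reesMonomial hx
    have hw' := hw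
    rw [pow_zero, Submodule.mem_one] at hw'
    obtain ⟨a, rfl⟩ := hw'
    exact ⟨a, Subtype.ext (Subtype.ext rfl)⟩

theorem reesMonomial_mem_adjoin {W : Submodule A F} {s : Set F} (hs : Submodule.span A s = W)
    (k : ℕ) (w : F) (hw : w ∈ W ^ k) : reesMonomial W k w hw ∈ Algebra.adjoin (reesGrading W 0)
      {x : reesSubalgebra W | ∃ w ∈ s, (x : F[X]) = monomial 1 w} := by
  set T := Algebra.adjoin (reesGrading W 0)
    {x : reesSubalgebra W | ∃ w ∈ s, (x : F[X]) = monomial 1 w}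
  have h0 : ∀ w hw, reesMonomial W 0 w hw ∈ T := fun w hw ↦
    T.algebraMap_mem ⟨reesMonomial W 0 w hw, reesMonomial_mem hw⟩
  have h1 : ∀ w hw, reesMonomial W 1 w hw ∈ T := by
    intro w hw
    have hw' := hw
    rw [pow_one, ← hs] at hw'
    induction hw' using Submodule.span_induction with
    | mem x h => exact Algebra.subset_adjoin ⟨x, h, rfl⟩
    | zero =>
      convert T.zero_mem
      exact Subtype.ext (map_zero (monomial 1))
    | add x y hx hy ihx ihy =>
      rw [hs, ← pow_one W] at hx hy
      convert T.add_mem (ihx hx) (ihy hy)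
      exact Subtype.ext (map_add (monomial 1) _ _)
    | smul a x hx ihx =>
      rw [hs, ← pow_one W] at hx
      have ha : algebraMap A F a ∈ W ^ 0 := by
        rw [pow_zero]
        exact Submodule.algebraMap_mem a
      convert T.mul_mem (h0 _ ha) (ihx hx)
      refine Subtype.ext ?_
      simp [reesMonomial, Algebra.smul_def]
  induction k generalizing w with
  | zero => exact h0 w hw
  | succ n ih =>
    have hw' := hw
    rw [pow_succ'] at hw'
    induction hw' using Submodule.mul_induction_on' with
    | mem_mul_mem x hx y hy =>
      rw [← pow_one W] at hx
      convert T.mul_mem (h1 x hx) (ih y hy)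
      refine Subtype.ext ?_
      simp [reesMonomial, monomial_mul_monomial, add_comm]
    | add x hx y hy ihx ihy =>
      rw [← pow_succ'] at hx hy
      convert T.add_mem (ihx hx) (ihy hy)
      exact Subtype.ext (map_add (monomial _) _ _)

theorem adjoin_reesMonomial_eq_top {W : Submodule A F} {s : Set F} (hs : Submodule.span A s = W) :
    Algebra.adjoin (reesGrading W 0)
      {x : reesSubalgebra W | ∃ w ∈ s, (x : F[X]) = monomial 1 w} = ⊤ := by
  refine top_le_iff.mp fun x _ ↦ ?_
  have : x = ∑ k ∈ (x : F[X]).support, reesMonomial W k _ (x.2 k) := by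
    refine Subtype.ext ?_
    rw [AddSubmonoidClass.coe_finsetSum]
    exact (x : F[X]).as_sum_support
  rw [this]
  exact Subalgebra.sum_mem _ fun k _ ↦ reesMonomial_mem_adjoin hs k _ _

theorem isStandardGraded_reesGrading [IsNoetherianRing A] [IsLocalRing A]
    (hA : Function.Injective (algebraMap A F)) {W : Submodule A F} (hW : W.FG) :
    IsStandardGraded (reesGrading W) := by
  let e : A ≃+* reesGrading W 0 :=
    RingEquiv.ofBijective _ (bijective_algebraMap_reesGrading_zero hA W)
  refine ⟨isNoetherianRing_reesSubalgebra hW, isNoetherianRing_of_ringEquiv A e,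
    RingEquiv.isLocalRing e, ?_⟩
  rw [eq_top_iff, ← adjoin_reesMonomial_eq_top (Submodule.span_eq W)]
  refine Algebra.adjoin_mono ?_
  rintro x ⟨w, hw, hx⟩
  rw [SetLike.mem_coe, mem_reesGrading, hx]
  simp

end Charts

/-! ### Points of `Proj` with values in a field -/

section AwayEval

open HomogeneousLocalization

variable {A R F : Type*} [CommRing A] [CommRing R] [Field F] [Algebra A R]
  {𝒜 : ℕ → Submodule A R} [GradedAlgebra 𝒜]

variable (𝒜) in
/-- The map `R_(r) → F`, `x / rⁿ ↦ ρ x / ρ rⁿ`, induced by a ring homomorphism `ρ : R → F` to a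
field with `ρ r ≠ 0`. -/
noncomputable def awayEval (ρ : R →+* F) (r : R) (hr : ρ r ≠ 0) : Away 𝒜 r →+* F :=
  (IsLocalization.Away.lift r (S := Localization.Away r) (g := ρ) (isUnit_iff_ne_zero.mpr hr)).comp
    (algebraMap (Away 𝒜 r) (Localization.Away r))

theorem awayEval_mk (ρ : R →+* F) {r : R} (hr : ρ r ≠ 0) {d : ℕ} (hd : r ∈ 𝒜 d) (n : ℕ) (x : R)
    (hx : x ∈ 𝒜 (n • d)) : awayEval 𝒜 ρ r hr (Away.mk 𝒜 hd n x hx) = ρ x / ρ r ^ n := by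
  rw [awayEval, RingHom.comp_apply, HomogeneousLocalization.algebraMap_apply, Away.val_mk,
    eq_div_iff (pow_ne_zero _ hr), Localization.mk_eq_mk', ← map_pow]
  have := IsLocalization.Away.lift_eq (S := Localization.Away r) (g := ρ) r
    (isUnit_iff_ne_zero.mpr hr)
  rw [← this, ← this x, ← map_mul]
  congr 1
  exact IsLocalization.mk'_spec (Localization.Away r) x ⟨r ^ n, _⟩

theorem awayEval_comp_awayMap (ρ : R →+* F) {r s : R} (hr : ρ r ≠ 0) {d e : ℕ}
    (hd : r ∈ 𝒜 d) (he : s ∈ 𝒜 e) {x : R} (hx : x = r * s) (hx0 : ρ x ≠ 0) :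
    (awayEval 𝒜 ρ x hx0).comp (awayMap 𝒜 he hx) = awayEval 𝒜 ρ r hr := by
  ext z
  obtain ⟨n, a, ha, rfl⟩ := Away.mk_surjective 𝒜 hd z
  rw [RingHom.comp_apply, awayMap_mk, awayEval_mk, awayEval_mk, hx, map_mul, map_mul, map_pow,
    mul_pow]
  have hs : ρ s ≠ 0 := fun h ↦ hx0 (by rw [hx, map_mul, h, mul_zero])
  field_simp

/-- The `F`-valued point of `Proj` defined by `ρ` does not depend on the chart used to define it. -/
theorem specMap_awayEval_awayι {R F : Type u} [CommRing R] [Field F] [Algebra A R]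
    {𝒜 : ℕ → Submodule A R} [GradedAlgebra 𝒜] (ρ : R →+* F) {r s : R} (hr : ρ r ≠ 0)
    (hs : ρ s ≠ 0) {d e : ℕ} (hd : r ∈ 𝒜 d) (hd0 : 0 < d) (he : s ∈ 𝒜 e) (he0 : 0 < e) :
    Spec.map (CommRingCat.ofHom (awayEval 𝒜 ρ r hr)) ≫ Proj.awayι 𝒜 r hd hd0 =
      Spec.map (CommRingCat.ofHom (awayEval 𝒜 ρ s hs)) ≫ Proj.awayι 𝒜 s he he0 := by
  have hrs : ρ (r * s) ≠ 0 := by rw [map_mul]; exact mul_ne_zero hr hs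
  have key : ∀ (m m' : ℕ) (h : m = m') (hm : r * s ∈ 𝒜 m) (hm0 : 0 < m) (hm' : r * s ∈ 𝒜 m')
      (hm0' : 0 < m'), Proj.awayι 𝒜 _ hm hm0 = Proj.awayι 𝒜 _ hm' hm0' := by
    rintro m _ rfl _ _ _ _
    rfl
  rw [← awayEval_comp_awayMap ρ hr hd he rfl hrs,
    ← awayEval_comp_awayMap ρ hs he hd (mul_comm r s) hrs, CommRingCat.ofHom_comp,
    CommRingCat.ofHom_comp, Spec.map_comp, Spec.map_comp, Category.assoc, Category.assoc,
    Proj.SpecMap_awayMap_awayι, Proj.SpecMap_awayMap_awayι, key _ _ (add_comm d e)]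

theorem awayEval_fromZeroRingHom (ρ : R →+* F) {r : R} (hr : ρ r ≠ 0) (a : 𝒜 0) :
    awayEval 𝒜 ρ r hr (fromZeroRingHom 𝒜 _ a) = ρ a := by
  rw [awayEval, RingHom.comp_apply]
  exact IsLocalization.Away.lift_eq r _ _

end AwayEval

/-! ### The standard charts of `Proj` of the Rees algebra -/

section ReesProj

open HomogeneousLocalization Polynomial

variable {A F : Type u} [CommRing A] [Field F] [Algebra A F]

/-- Evaluation of the Rees algebra at `X = 1`. -/
noncomputable def reesEval (W : Submodule A F) : reesSubalgebra W →+* F :=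
  (Polynomial.evalRingHom 1).comp (algebraMap (reesSubalgebra W) F[X])

theorem reesEval_reesMonomial {W : Submodule A F} {k : ℕ} {w : F} (hw : w ∈ W ^ k) :
    reesEval W (reesMonomial W k w hw) = w := by
  change eval 1 (monomial k w) = w
  simp

/-- `reesEval` is injective on each homogeneous component. -/
theorem reesEval_injOn {W : Submodule A F} {k : ℕ} {x : reesSubalgebra W} (hx : x ∈ reesGrading W k)
    (h : reesEval W x = 0) : x = 0 := by
  obtain ⟨w, hw, rfl⟩ := exists_eq_reesMonomial hx
  rw [reesEval_reesMonomial] at h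
  subst h
  exact Subtype.ext (map_zero (monomial k))

theorem awayEval_reesEval_injective {W : Submodule A F} {k : ℕ} {r : reesSubalgebra W}
    (hr : r ∈ reesGrading W k) (hr0 : reesEval W r ≠ 0) :
    Function.Injective (awayEval (reesGrading W) (reesEval W) r hr0) := by
  rw [injective_iff_map_eq_zero]
  intro z hz
  obtain ⟨n, a, ha, rfl⟩ := Away.mk_surjective _ hr z
  rw [awayEval_mk, div_eq_zero_iff, or_iff_left (pow_ne_zero _ hr0)] at hz
  obtain rfl := reesEval_injOn ha hz
  ext
  rw [Away.val_mk, Localization.mk_zero, HomogeneousLocalization.val_zero]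

/-- The chart of `Proj` of the Rees algebra of `W` at `w X` is the spectrum of `⋃ₖ Wᵏ / wᵏ`. -/
theorem mem_range_awayEval_reesEval {W : Submodule A F} {w : F} (hw : w ∈ W) (hw0 : w ≠ 0)
    (hw1 : w ∈ W ^ 1) (hr0 : reesEval W (reesMonomial W 1 w hw1) ≠ 0) (g : F) :
    (∃ z, awayEval (reesGrading W) (reesEval W) (reesMonomial W 1 w hw1) hr0 z = g) ↔
      g ∈ chartAlgebra W w hw := by
  rw [mem_chartAlgebra]
  constructor
  · rintro ⟨z, rfl⟩
    obtain ⟨n, a, ha, rfl⟩ := Away.mk_surjective _ (reesMonomial_mem hw1) z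
    refine ⟨n, ?_⟩
    rw [awayEval_mk, reesEval_reesMonomial, mul_div_cancel₀ _ (pow_ne_zero _ hw0)]
    obtain ⟨v, hv, rfl⟩ := exists_eq_reesMonomial ha
    rw [reesEval_reesMonomial]
    simpa using hv
  · rintro ⟨n, hn⟩
    have hn' : w ^ n * g ∈ W ^ (n • 1) := by simpa using hn
    refine ⟨Away.mk _ (reesMonomial_mem hw1) n (reesMonomial W (n • 1) _ hn') (reesMonomial_mem _),
      ?_⟩
    rw [awayEval_mk, reesEval_reesMonomial, reesEval_reesMonomial,
      mul_div_cancel_left₀ _ (pow_ne_zero _ hw0)]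

open scoped Pointwise in
/-- `Proj` of the Rees algebra of `V^d` is covered by the charts of the `fᵢ^d`, where the `fᵢ`
generate `V`. -/
theorem iSup_basicOpen_reesGrading_eq_top {ι : Type*} {f : ι → F} {V : Submodule A F}
    (hV : Submodule.span A (Set.range f) = V) {d : ℕ} (hd : 0 < d)
    (hf : ∀ i, f i ^ d ∈ (V ^ d) ^ 1) :
    ⨆ i : {i // f i ≠ 0}, Proj.basicOpen (reesGrading (V ^ d))
      (reesMonomial (V ^ d) 1 _ (hf i)) = ⊤ := by
  -- the `d`-th powers of the degree `d` monomials in the `fᵢ` are products of the `fᵢ^d`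
  refine top_le_iff.mp fun x _ ↦ ?_
  have hspan : Submodule.span A (Set.range f ^ d) = V ^ d := by rw [← Submodule.span_pow, hV]
  have hcov := Proj.iSup_basicOpen_eq_top' (reesGrading (V ^ d))
    (fun w : ↥(Set.range f ^ d : Set F) ↦ reesMonomial (V ^ d) 1 w.1
      (by rw [pow_one, ← hspan]; exact Submodule.subset_span w.2))
    (fun i ↦ ⟨1, reesMonomial_mem _⟩) ?_
  · have hx : x ∈ (⊤ : (Proj (reesGrading (V ^ d))).Opens) := trivial
    rw [← hcov, TopologicalSpace.Opens.mem_iSup] at hx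
    obtain ⟨⟨w, hw⟩, hx⟩ := hx
    obtain ⟨g, hg⟩ := Set.mem_pow.mp hw
    rw [TopologicalSpace.Opens.mem_iSup]
    by_contra! hcon
    rw [Proj.mem_basicOpen] at hx
    choose j hj using fun i : Fin d ↦ (g i).2
    have hfj : ∀ i, f (j i) ^ d ∈ (V ^ d) ^ 1 := fun i ↦ hf _
    have hmem : ∀ i, f i ≠ 0 →
        reesMonomial (V ^ d) 1 (f i ^ d) (hf i) ∈ x.asHomogeneousIdeal.toIdeal := by
      intro i hi
      simpa [Proj.mem_basicOpen] using hcon ⟨i, hi⟩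
    have hmem' : ∀ i, reesMonomial (V ^ d) 1 (f i ^ d) (hf i) ∈ x.asHomogeneousIdeal.toIdeal := by
      intro i
      by_cases hi : f i = 0
      · convert zero_mem x.asHomogeneousIdeal.toIdeal
        refine Subtype.ext ?_
        simp [reesMonomial, hi, hd.ne']
      · exact hmem i hi
    have hprime := x.isPrime
    refine hx (hprime.mem_of_pow_mem d ?_)
    have : reesMonomial (V ^ d) 1 w (by rw [pow_one, ← hspan]; exact Submodule.subset_span hw) ^ d =
        ∏ i, reesMonomial (V ^ d) 1 (f (j i) ^ d) (hf (j i)) := by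
      refine Subtype.ext ?_
      rw [SubmonoidClass.coe_finsetProd]
      simp only [reesMonomial, SubmonoidClass.mk_pow, ← C_mul_X_pow_eq_monomial,
        Finset.prod_mul_distrib, ← map_prod, hj, Finset.prod_const, Finset.card_univ,
        Fintype.card_fin, Finset.prod_pow, mul_pow, pow_one, ← hg, List.prod_ofFn, map_pow]
    rw [this, hprime.prod_mem_iff]
    exact ⟨⟨0, hd⟩, Finset.mem_univ _, hmem' _⟩
  · rw [← adjoin_reesMonomial_eq_top hspan]
    congr 1
    ext y
    constructor
    · rintro ⟨w, rfl⟩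
      exact ⟨w, w.2, rfl⟩
    · rintro ⟨w, hw, hy⟩
      exact ⟨⟨w, hw⟩, Subtype.ext hy.symm⟩

end ReesProj

/-! ### The standard charts of projective space -/

section MvPolynomial

open HomogeneousLocalization MvPolynomial

attribute [local instance] MvPolynomial.gradedAlgebra

variable {A F : Type u} {σ : Type*} [CommRing A] [Field F] [Algebra A F]

theorem eval₂_mul_of_isHomogeneous {R S : Type*} [CommSemiring R] [CommSemiring S] (φ : R →+* S)
    {p : MvPolynomial σ R} {n : ℕ} (hp : p.IsHomogeneous n) (c : S) (y : σ → S) :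
    eval₂ φ (fun j ↦ c * y j) p = c ^ n * eval₂ φ y p := by
  rw [eval₂_eq, eval₂_eq, Finset.mul_sum]
  refine Finset.sum_congr rfl fun d hd ↦ ?_
  have hdn : d.degree = n := by
    rw [Finsupp.degree_eq_weight_one]
    exact hp (mem_support_iff.mp hd)
  simp only [mul_pow, Finset.prod_mul_distrib, Finset.prod_pow_eq_pow_sum]
  rw [← hdn, Finsupp.degree_apply]
  ring

/-- The homogeneous polynomials of degree `k` evaluated at the `fᵢ` fill the `k`-th power of the
span of the `fᵢ`. -/
theorem mem_span_range_pow_iff {f : σ → F} {k : ℕ} {v : F} :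
    v ∈ Submodule.span A (Set.range f) ^ k ↔
      ∃ p : MvPolynomial σ A, p.IsHomogeneous k ∧ aeval f p = v := by
  constructor
  · intro hv
    induction k generalizing v with
    | zero =>
      rw [pow_zero, Submodule.mem_one] at hv
      obtain ⟨a, rfl⟩ := hv
      exact ⟨C a, isHomogeneous_C _ a, aeval_C f a⟩
    | succ k ih =>
      rw [pow_succ'] at hv
      induction hv using Submodule.mul_induction_on' with
      | mem_mul_mem x hx y hy =>
        obtain ⟨q, hq, rfl⟩ := ih hy
        clear hy
        induction hx using Submodule.span_induction with
        | mem x h =>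
          obtain ⟨i, rfl⟩ := h
          exact ⟨X i * q, add_comm 1 k ▸ (isHomogeneous_X A i).mul hq, by simp⟩
        | zero => exact ⟨0, isHomogeneous_zero _ _ _, by simp⟩
        | add x y _ _ ihx ihy =>
          obtain ⟨p, hp, hpx⟩ := ihx
          obtain ⟨p', hp', hpx'⟩ := ihy
          exact ⟨p + p', hp.add hp', by rw [map_add, hpx, hpx', add_mul]⟩
        | smul a x _ ih =>
          obtain ⟨p, hp, hpx⟩ := ih
          exact ⟨a • p, (homogeneousSubmodule σ A (k + 1)).smul_mem a hp,
            by rw [map_smul, hpx, smul_mul_assoc]⟩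
      | add x _ y _ ihx ihy =>
        obtain ⟨p, hp, rfl⟩ := ihx
        obtain ⟨p', hp', rfl⟩ := ihy
        exact ⟨p + p', hp.add hp', map_add _ _ _⟩
  · rintro ⟨p, hp, rfl⟩
    rw [aeval_def, eval₂_eq]
    refine Submodule.sum_mem _ fun d hd ↦ ?_
    have hdn : d.degree = k := by
      rw [Finsupp.degree_eq_weight_one]
      exact hp (mem_support_iff.mp hd)
    rw [← Algebra.smul_def]
    refine Submodule.smul_mem _ _ ?_
    rw [← hdn, Finsupp.degree_apply]
    rw [← Finset.prod_pow_eq_pow_sum]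
    have h : ∀ s : Finset σ, ∏ i ∈ s, f i ^ d i ∈
        ∏ i ∈ s, Submodule.span A (Set.range f) ^ d i := by
      classical
      intro s
      induction s using Finset.induction_on with
      | empty => exact Submodule.one_le.mp le_rfl
      | insert i s hi ih =>
        rw [Finset.prod_insert hi, Finset.prod_insert hi]
        exact Submodule.mul_mem_mul
          (Submodule.pow_mem_pow _ (Submodule.subset_span (Set.mem_range_self i)) _) ih
    exact h _

/-- The image of the coordinate ring of `D₊(xᵢ)` under `xⱼ ↦ fⱼ` is a chart algebra of the span of
the `fⱼ`. -/
theorem mem_range_awayEval_aeval {f : σ → F} {i : σ} (hi : f i ∈ Submodule.span A (Set.range f))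
    (hi0 : (aeval f : MvPolynomial σ A →ₐ[A] F).toRingHom (X i) ≠ 0) (g : F) :
    (∃ z, awayEval (homogeneousSubmodule σ A) (aeval f : MvPolynomial σ A →ₐ[A] F).toRingHom (X i)
      hi0 z = g) ↔ g ∈ chartAlgebra (Submodule.span A (Set.range f)) (f i) hi := by
  have hX : (X i : MvPolynomial σ A) ∈ homogeneousSubmodule σ A 1 := isHomogeneous_X A i
  have h1 : (aeval f : MvPolynomial σ A →ₐ[A] F).toRingHom (X i) = f i := aeval_X f i
  have hfi : f i ≠ 0 := h1 ▸ hi0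
  rw [mem_chartAlgebra]
  constructor
  · rintro ⟨z, rfl⟩
    obtain ⟨n, p, hp, rfl⟩ := Away.mk_surjective _ hX z
    refine ⟨n, ?_⟩
    rw [awayEval_mk, h1, mul_div_cancel₀ _ (pow_ne_zero _ hfi)]
    exact mem_span_range_pow_iff.mpr ⟨p, by simpa using hp, rfl⟩
  · rintro ⟨n, hn⟩
    obtain ⟨p, hp, hpg⟩ := mem_span_range_pow_iff.mp hn
    refine ⟨Away.mk _ hX n p (by simpa using hp), ?_⟩
    rw [awayEval_mk, h1]
    change aeval f p / f i ^ n = g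
    rw [hpg, mul_div_cancel_left₀ _ (pow_ne_zero _ hfi)]

theorem X_mem_homogeneousSubmodule (A : Type u) [CommRing A] (i : σ) :
    (X i : MvPolynomial σ A) ∈ homogeneousSubmodule σ A 1 := isHomogeneous_X A i

theorem X_mem_homogeneousSubmodule_smul (A : Type u) [CommRing A] (i : σ) :
    (X i : MvPolynomial σ A) ∈ homogeneousSubmodule σ A (1 • 1) := isHomogeneous_X A i

/-- The coordinate function `xⱼ / xᵢ` on the chart `D₊(xᵢ)` of projective space. -/
noncomputable def awayCoord (A : Type u) [CommRing A] (i j : σ) :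
    Away (homogeneousSubmodule σ A) (X i : MvPolynomial σ A) :=
  Away.mk _ (X_mem_homogeneousSubmodule A i) 1 (X j) (X_mem_homogeneousSubmodule_smul A j)

theorem awayCoord_self (A : Type u) [CommRing A] (i : σ) : awayCoord A i i = 1 := by
  ext
  rw [awayCoord, Away.val_mk, HomogeneousLocalization.val_one]
  simp only [pow_one]
  exact Localization.mk_self (⟨X i, ⟨1, pow_one _⟩⟩ : Submonoid.powers (X i : MvPolynomial σ A))

/-- A homomorphism from the coordinate ring of the chart `D₊(xᵢ)` to a field is determined by the
images of the constants and of the coordinate functions `xⱼ / xᵢ`. -/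
theorem eq_awayEval_aeval {i : σ}
    (χ : Away (homogeneousSubmodule σ A) (X i : MvPolynomial σ A) →+* F)
    (hχ : ∀ a, χ (fromZeroRingHom _ _ (algebraMap A (homogeneousSubmodule σ A 0) a)) =
      algebraMap A F a) {f : σ → F} (hf : ∀ j, χ (awayCoord A i j) = f j)
    (hi0 : (aeval f : MvPolynomial σ A →ₐ[A] F).toRingHom (X i) ≠ 0) :
    χ = awayEval _ (aeval f : MvPolynomial σ A →ₐ[A] F).toRingHom (X i) hi0 := by
  have hX : (X i : MvPolynomial σ A) ∈ homogeneousSubmodule σ A 1 := isHomogeneous_X A i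
  let L := Localization.Away (X i : MvPolynomial σ A)
  let a₀ : A →+* Away (homogeneousSubmodule σ A) (X i : MvPolynomial σ A) :=
    (fromZeroRingHom _ _).comp (algebraMap A (homogeneousSubmodule σ A 0))
  have hone : f i = 1 := by
    rw [← hf i, awayCoord_self, map_one]
  -- a homogeneous polynomial of degree `n` in the `xⱼ / xᵢ` equals `p / xᵢⁿ`
  have key : ∀ (n : ℕ) (p : MvPolynomial σ A) (hp : p ∈ homogeneousSubmodule σ A (n • 1)),
      Away.mk _ hX n p hp = eval₂ a₀ (awayCoord A i) p := by
    intro n p hp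
    ext
    rw [Away.val_mk, Localization.mk_eq_mk'_apply, IsLocalization.mk'_eq_iff_eq_mul]
    have h1 : (eval₂ a₀ (awayCoord A i) p).val =
        eval₂ (algebraMap A L) (fun j ↦ (awayCoord A i j).val) p := by
      have := eval₂_comp_left (algebraMap (Away (homogeneousSubmodule σ A)
        (X i : MvPolynomial σ A)) L) a₀ (awayCoord A i) p
      rw [HomogeneousLocalization.algebraMap_apply] at this
      rw [this]
      congr 1
    have h2 : ∀ j, algebraMap (MvPolynomial σ A) L (X i) * (awayCoord A i j).val =
        algebraMap (MvPolynomial σ A) L (X j) := by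
      intro j
      rw [awayCoord, Away.val_mk, Localization.mk_eq_mk'_apply]
      simp only [pow_one]
      exact IsLocalization.mk'_spec' L (X j)
        (⟨X i, ⟨1, pow_one _⟩⟩ : Submonoid.powers (X i : MvPolynomial σ A))
    rw [h1, mul_comm]
    change _ = algebraMap (MvPolynomial σ A) L (X i ^ n) * _
    rw [map_pow, ← eval₂_mul_of_isHomogeneous _ (by simpa using hp : p.IsHomogeneous n)]
    simp only [h2]
    have h3 := eval₂_comp_left (algebraMap (MvPolynomial σ A) L) C X p
    rw [eval₂_eta] at h3
    exact h3
  ext z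
  obtain ⟨n, p, hp, rfl⟩ := Away.mk_surjective _ hX z
  rw [awayEval_mk, key, eval₂_comp_left χ]
  change _ = aeval f p / aeval f (X i) ^ n
  rw [aeval_X, hone, one_pow, div_one, aeval_def]
  congr 1
  · ext a
    exact hχ a
  · ext j
    exact hf j

end MvPolynomial

/-! ### Gluing along a common dominant point -/

section Gluing

/-- Morphisms on charts of `X` which agree on a common dominant point `T` glue to a morphism to a
separated scheme. -/
theorem exists_hom_of_charts {X Y T : Scheme.{u}} [Y.IsSeparated] {ι : Type*} (U : ι → Scheme.{u})
    [∀ i, IsReduced (U i)] (u : ∀ i, U i ⟶ X) (v : ∀ i, U i ⟶ Y) [∀ i, IsOpenImmersion (u i)]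
    (hu : ∀ x, ∃ i, x ∈ Set.range (u i)) (τ : ∀ i, T ⟶ U i) [∀ i, IsDominant (τ i)]
    (hτu : ∀ i j, τ i ≫ u i = τ j ≫ u j) (hτv : ∀ i j, τ i ≫ v i = τ j ≫ v j) :
    ∃ φ : X ⟶ Y, ∀ i, u i ≫ φ = v i := by
  let 𝒰 : X.OpenCover := Scheme.Cover.mkOfCovers ι U u (by simpa using hu) inferInstance
  have hdom : ∀ i j, IsDominant (pullback.lift (τ i) (τ j) (hτu i j)) := by
    intro i j
    have : IsDominant (pullback.lift (τ i) (τ j) (hτu i j) ≫ pullback.fst (u i) (u j)) := by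
      rw [pullback.lift_fst]
      infer_instance
    exact IsDominant.of_comp_of_isOpenImmersion _ (pullback.fst (u i) (u j))
  have hcomp : ∀ i j, pullback.fst (u i) (u j) ≫ v i = pullback.snd (u i) (u j) ≫ v j := by
    intro i j
    have := hdom i j
    have : IsReduced (pullback (u i) (u j)) := isReduced_of_isOpenImmersion (pullback.fst _ _)
    refine ext_of_isDominant (pullback.lift (τ i) (τ j) (hτu i j)) ?_
    rw [pullback.lift_fst_assoc, pullback.lift_snd_assoc, hτv i j]
  exact ⟨𝒰.glueMorphisms v hcomp, fun i ↦ 𝒰.ι_glueMorphisms v hcomp i⟩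

theorem hom_ext_of_charts {X Y : Scheme.{u}} {ι : Type*} (U : ι → Scheme.{u})
    (u : ∀ i, U i ⟶ X) [∀ i, IsOpenImmersion (u i)] (hu : ∀ x, ∃ i, x ∈ Set.range (u i))
    {f g : X ⟶ Y} (h : ∀ i, u i ≫ f = u i ≫ g) : f = g :=
  (Scheme.Cover.mkOfCovers ι U u (by simpa using hu) inferInstance : X.OpenCover).hom_ext _ _ h

/-- Two separated schemes with the same charts, glued compatibly with a common dominant point, are
isomorphic. -/
theorem exists_iso_of_charts {X Y T : Scheme.{u}} [X.IsSeparated] [Y.IsSeparated] {ι : Type*}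
    (U : ι → Scheme.{u}) [∀ i, IsReduced (U i)] (u : ∀ i, U i ⟶ X) (v : ∀ i, U i ⟶ Y)
    [∀ i, IsOpenImmersion (u i)] [∀ i, IsOpenImmersion (v i)]
    (hu : ∀ x, ∃ i, x ∈ Set.range (u i)) (hv : ∀ x, ∃ i, x ∈ Set.range (v i))
    (τ : ∀ i, T ⟶ U i) [∀ i, IsDominant (τ i)]
    (hτu : ∀ i j, τ i ≫ u i = τ j ≫ u j) (hτv : ∀ i j, τ i ≫ v i = τ j ≫ v j) :
    ∃ e : X ≅ Y, ∀ i, u i ≫ e.hom = v i := by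
  obtain ⟨φ, hφ⟩ := exists_hom_of_charts U u v hu τ hτu hτv
  obtain ⟨ψ, hψ⟩ := exists_hom_of_charts U v u hv τ hτv hτu
  refine ⟨⟨φ, ψ, ?_, ?_⟩, hφ⟩
  · exact hom_ext_of_charts U u hu fun i ↦ by rw [reassoc_of% hφ i, hψ, Category.comp_id]
  · exact hom_ext_of_charts U v hv fun i ↦ by rw [reassoc_of% hψ i, hφ, Category.comp_id]

end Gluing

/-! ### Normal Noetherian schemes -/

section Normal

/-- A space with finitely many irreducible components, every point of which lies on only one of
them, is irreducible as soon as it is connected. -/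
theorem irreducibleSpace_of_connectedSpace {X : Type*} [TopologicalSpace X] [ConnectedSpace X]
    (hfin : (irreducibleComponents X).Finite)
    (h : ∀ x : X, ∀ Z ∈ irreducibleComponents X, ∀ Z' ∈ irreducibleComponents X, x ∈ Z → x ∈ Z' →
      Z = Z') : IrreducibleSpace X := by
  obtain ⟨x⟩ := (inferInstance : Nonempty X)
  set Z := irreducibleComponent x
  have hZ : Z ∈ irreducibleComponents X := irreducibleComponent_mem_irreducibleComponents x
  have hcompl : Zᶜ = ⋃₀ (irreducibleComponents X \ {Z}) := by
    ext y
    constructor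
    · intro hy
      refine ⟨irreducibleComponent y, ⟨irreducibleComponent_mem_irreducibleComponents y, ?_⟩,
        mem_irreducibleComponent⟩
      intro hyZ
      exact hy ((hyZ : irreducibleComponent y = Z) ▸ mem_irreducibleComponent)
    · rintro ⟨Z', ⟨hZ', hne⟩, hy⟩ hyZ
      exact hne (h y Z' hZ' Z hZ hy hyZ)
  have hopen : IsOpen Z := by
    rw [← isClosed_compl_iff, hcompl, Set.sUnion_eq_biUnion]
    exact (hfin.subset Set.sdiff_subset).isClosed_biUnion fun Z' hZ' ↦
      isClosed_of_mem_irreducibleComponents Z' hZ'.1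
  have huniv : Z = Set.univ :=
    IsClopen.eq_univ ⟨isClosed_irreducibleComponent, hopen⟩ ⟨x, mem_irreducibleComponent⟩
  have : IsIrreducible (Set.univ : Set X) := huniv ▸ isIrreducible_irreducibleComponent
  exact (irreducibleSpace_def X).mpr this

/-- A point of a scheme with integral local ring lies on only one irreducible component. -/
theorem eq_of_mem_irreducibleComponents {X : Scheme.{u}} (x : X) [IsDomain (X.presheaf.stalk x)]
    {Z : Set X} (hZ : Z ∈ irreducibleComponents X) (hx : x ∈ Z) :
    Z = closure {X.fromSpecStalk x (genericPoint (Spec (X.presheaf.stalk x)))} := by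
  have hcl := isClosed_of_mem_irreducibleComponents Z hZ
  obtain ⟨η, hη⟩ := QuasiSober.sober hZ.1 hcl
  have hηx : η ⤳ x := hη.specializes hx
  obtain ⟨y, hy⟩ : η ∈ Set.range (X.fromSpecStalk x) := by rwa [Scheme.range_fromSpecStalk]
  have hsp : X.fromSpecStalk x (genericPoint (Spec (X.presheaf.stalk x))) ⤳ η := by
    rw [← hy]
    exact (genericPoint_specializes y).map (X.fromSpecStalk x).continuous
  refine Set.Subset.antisymm ?_ (hZ.2 isIrreducible_singleton.closure ?_)
  · rw [← hη]
    exact closure_minimal (Set.singleton_subset_iff.mpr hsp.mem_closure) isClosed_closure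
  · rw [← hη]
    exact closure_minimal (Set.singleton_subset_iff.mpr hsp.mem_closure) isClosed_closure

/-- A connected normal Noetherian scheme is integral. -/
theorem isIntegral_of_isNormalScheme (X : Scheme.{u}) [IsNormalScheme X] [ConnectedSpace X]
    [IsNoetherian X] : IsIntegral X := by
  have hdom := IsNormalScheme.isDomain_stalk (X := X)
  have : IsReduced X := isReduced_of_isReduced_stalk X
  have : IrreducibleSpace X := irreducibleSpace_of_connectedSpace
    finite_irreducibleComponents_of_isNoetherian fun x Z hZ Z' hZ' hx hx' ↦ by
      rw [eq_of_mem_irreducibleComponents x hZ hx, eq_of_mem_irreducibleComponents x hZ' hx']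
  exact isIntegral_of_irreducibleSpace_of_isReduced X

/-- Integral closedness of the sections over an affine open is checked on its local rings. -/
theorem isIntegrallyClosed_of_isAffineOpen {X : Scheme.{u}} [IsNormalScheme X] [IsIntegral X]
    {U : X.Opens} (hU : IsAffineOpen U) [Nonempty U] : IsIntegrallyClosed Γ(X, U) := by
  have key (y : PrimeSpectrum Γ(X, U)) (hy : hU.fromSpec y ∈ U) :
      IsIntegrallyClosed (Localization.AtPrime y.asIdeal) := by
    let : Algebra Γ(X, U) (X.presheaf.stalk (hU.fromSpec y)) :=
      X.presheaf.algebra_section_stalk ⟨hU.fromSpec y, hy⟩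
    have : IsLocalization y.asIdeal.primeCompl (X.presheaf.stalk (hU.fromSpec y)) :=
      hU.isLocalization_stalk' y hy
    have := IsNormalScheme.isIntegrallyClosed_stalk (hU.fromSpec y)
    exact .of_equiv (IsLocalization.algEquiv y.asIdeal.primeCompl
      (X.presheaf.stalk (hU.fromSpec y)) (Localization.AtPrime y.asIdeal)).toRingEquiv
  exact IsIntegrallyClosed.of_localization_maximal fun p _ _ ↦
    key ⟨p, inferInstance⟩ (hU.range_fromSpec.le ⟨_, rfl⟩)

end Normal

/-! ### Finite extensions over which a geometrically connected scheme is defined -/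

section Geometric

open TensorProduct

theorem finrank_eq_one_of_lmul_injective {K M : Type*} [Field K] [Field M] [Algebra K M]
    [FiniteDimensional K M]
    (h : Function.Injective (Algebra.TensorProduct.lmul' K : M ⊗[K] M →ₐ[K] M)) :
    Module.finrank K M = 1 := by
  have h1 := LinearMap.finrank_le_finrank_of_injective (f := (Algebra.TensorProduct.lmul' K :
    M ⊗[K] M →ₐ[K] M).toLinearMap) h
  rw [Module.finrank_tensorProduct] at h1
  have h2 : 0 < Module.finrank K M := Module.finrank_pos
  nlinarith

theorem finrank_eq_one_of_isDomain_tensorProduct {K M : Type*} [Field K] [Field M] [Algebra K M]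
    [FiniteDimensional K M] [IsDomain (M ⊗[K] M)] : Module.finrank K M = 1 := by
  have : IsArtinianRing (M ⊗[K] M) := IsArtinianRing.of_finite K _
  have hf : IsField (M ⊗[K] M) := IsArtinianRing.isField_of_isDomain _
  let := hf.toField
  exact finrank_eq_one_of_lmul_injective (RingHom.injective
    (Algebra.TensorProduct.lmul' K : M ⊗[K] M →ₐ[K] M).toRingHom)

/-- For a separable extension the kernel of `M ⊗ M → M` is generated by an idempotent, which is
trivial when the spectrum is connected. -/
theorem finrank_eq_one_of_connectedSpace {K M : Type*} [Field K] [Field M] [Algebra K M]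
    [FiniteDimensional K M] [Algebra.IsSeparable K M]
    [ConnectedSpace (PrimeSpectrum (M ⊗[K] M))] : Module.finrank K M = 1 := by
  have := Algebra.FormallyUnramified.of_isSeparable K M
  have hI : IsIdempotentElem (KaehlerDifferential.ideal K M) :=
    (Ideal.cotangent_subsingleton_iff _).mp
      (Algebra.FormallyUnramified.subsingleton_kaehlerDifferential (R := K) (A := M))
  obtain ⟨e, he, hspan⟩ := (Ideal.isIdempotentElem_iff_of_fg _
    (KaehlerDifferential.ideal_fg K M)).mp hI
  apply finrank_eq_one_of_lmul_injective
  have hker : RingHom.ker (Algebra.TensorProduct.lmul' K : M ⊗[K] M →ₐ[K] M) =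
    Ideal.span {e} := hspan
  rw [injective_iff_map_eq_zero]
  intro x hx
  have hx' : x ∈ RingHom.ker (Algebra.TensorProduct.lmul' K : M ⊗[K] M →ₐ[K] M) := hx
  have hclopen := PrimeSpectrum.isClopen_iff.mpr ⟨e, he, rfl⟩
  rcases isClopen_iff.mp hclopen with h | h
  · have : e = 0 := PrimeSpectrum.basicOpen_injOn_isIdempotentElem he IsIdempotentElem.zero
      (TopologicalSpace.Opens.ext (by simpa using h))
    rw [hker, this] at hx'
    simpa using hx'
  · have : e = 1 := PrimeSpectrum.basicOpen_injOn_isIdempotentElem he IsIdempotentElem.one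
      (TopologicalSpace.Opens.ext (by simpa using h))
    have h1 : (1 : M ⊗[K] M) ∈ RingHom.ker (Algebra.TensorProduct.lmul' K : M ⊗[K] M →ₐ[K] M) := by
      rw [hker, this]
      exact Ideal.mem_span_singleton_self _
    rw [RingHom.mem_ker, map_one] at h1
    exact absurd h1 one_ne_zero

/-- If the structure morphism of a geometrically connected (in characteristic zero) or geometrically
integral `K`-scheme factors through a finite extension `M`, then `M = K`: the base change to `M`
dominates `Spec (M ⊗ M)`. -/
theorem finrank_eq_one_of_geometrically {K M : Type u} [Field K] [Field M] [Algebra K M]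
    [FiniteDimensional K M] {Y : Scheme.{u}} [Nonempty Y] [CompactSpace Y]
    (s : Y ⟶ Spec (.of K)) (q : Y ⟶ Spec (.of M))
    (hq : q ≫ Spec.map (CommRingCat.ofHom (algebraMap K M)) = s)
    (h : (CharZero K ∧ GeometricallyConnected s) ∨ GeometricallyIntegral s) :
    Module.finrank K M = 1 := by
  let p₁ : Spec (.of (M ⊗[K] M)) ⟶ Spec (.of M) :=
    Spec.map (CommRingCat.ofHom (algebraMap M (M ⊗[K] M)))
  let p₂ : Spec (.of (M ⊗[K] M)) ⟶ Spec (.of M) :=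
    Spec.map (CommRingCat.ofHom Algebra.TensorProduct.includeRight.toRingHom)
  have hW : IsPullback p₁ p₂ (Spec.map (CommRingCat.ofHom (algebraMap K M)))
      (Spec.map (CommRingCat.ofHom (algebraMap K M))) :=
    isPullback_SpecMap_of_isPushout _ _ _ _ (CommRingCat.isPushout_tensorProduct K M M)
  have hZ : IsPullback (pullback.fst q p₁) (pullback.snd q p₁) q p₁ := .of_hasPullback _ _
  have hsurj : Surjective q := by
    refine ⟨fun x ↦ ?_⟩
    obtain ⟨y⟩ := (inferInstance : Nonempty Y)
    exact ⟨y, Subsingleton.elim (α := PrimeSpectrum M) _ _⟩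
  have hpaste := hZ.paste_vert hW
  rw [hq] at hpaste
  rcases h with ⟨_, h⟩ | h
  · have : ConnectedSpace ↥(pullback q p₁) := h.geometrically_connectedSpace _ _ _ hpaste
    have : ConnectedSpace (PrimeSpectrum (M ⊗[K] M)) :=
      (pullback.snd q p₁).surjective.connectedSpace (pullback.snd q p₁).continuous
    exact finrank_eq_one_of_connectedSpace
  · have : IsIntegral (pullback q p₁) := h.geometrically_isIntegral _ _ _ hpaste
    have : IsSchemeTheoreticallyDominant q := .of_isDominant q
    have : IsDomain Γ(pullback q p₁, pullback.snd q p₁ ⁻¹ᵁ ⊤) :=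
      inferInstanceAs (IsDomain Γ(pullback q p₁, ⊤))
    have hinj := (pullback.snd q p₁).app_injective ⊤
    have : IsDomain Γ(Spec (.of (M ⊗[K] M)), ⊤) := hinj.isDomain
      ((pullback.snd q p₁).app ⊤).hom
    have : IsDomain (M ⊗[K] M) := MulEquiv.isDomain _
      (Scheme.ΓSpecIso (.of (M ⊗[K] M))).symm.commRingCatIsoToRingEquiv.toMulEquiv
    exact finrank_eq_one_of_isDomain_tensorProduct

end Geometric

/-! ### Global sections integral over the base -/

section GlobalSections

/-- The ring homomorphism `A → Γ(X, ⊤)` of a scheme over `Spec A`. -/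
noncomputable def structureHom {A : Type u} [CommRing A] {X : Scheme.{u}}
    (f : X ⟶ Spec (CommRingCat.of A)) : A →+* Γ(X, ⊤) :=
  ((Scheme.ΓSpecIso (CommRingCat.of A)).inv ≫ f.appTop).hom

theorem toSpecΓ_structureHom {A : Type u} [CommRing A] {X : Scheme.{u}}
    (f : X ⟶ Spec (CommRingCat.of A)) :
    X.toSpecΓ ≫ Spec.map (CommRingCat.ofHom (structureHom f)) = f := by
  rw [structureHom, CommRingCat.ofHom_hom, Spec.map_comp, ← Scheme.toSpecΓ_naturality_assoc,
    toSpecΓ_SpecMap_ΓSpecIso_inv, Category.comp_id]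

theorem structureHom_comp {A : Type u} [CommRing A] {X Y : Scheme.{u}}
    (f : X ⟶ Spec (CommRingCat.of A)) (g : Y ⟶ X) :
    structureHom (g ≫ f) = g.appTop.hom.comp (structureHom f) := by
  rw [structureHom, structureHom, Scheme.Hom.comp_appTop, ← CommRingCat.hom_comp, Category.assoc]

theorem structureHom_comp_specMap {A B : Type u} [CommRing A] [CommRing B] {X : Scheme.{u}}
    (f : X ⟶ Spec (CommRingCat.of B)) (φ : A →+* B) :
    structureHom (f ≫ Spec.map (CommRingCat.ofHom φ)) = (structureHom f).comp φ := by
  have := Scheme.ΓSpecIso_inv_naturality (CommRingCat.ofHom φ)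
  rw [structureHom, structureHom, Scheme.Hom.comp_appTop, ← reassoc_of% this]
  rfl

/-- A surjective morphism to an integral `Spec A` hits the generic point, so no nonzero `a` vanishes
on `X`. -/
theorem structureHom_injective {A : Type u} [CommRing A] [IsDomain A] {X : Scheme.{u}}
    (f : X ⟶ Spec (CommRingCat.of A)) [Surjective f] : Function.Injective (structureHom f) := by
  rw [injective_iff_map_eq_zero]
  intro a ha
  obtain ⟨y, hy⟩ := f.surjective (⊥ : PrimeSpectrum A)
  rw [← toSpecΓ_structureHom f, Scheme.Hom.comp_apply] at hy
  have h1 : ((X.toSpecΓ y : PrimeSpectrum Γ(X, ⊤)).asIdeal).comap (structureHom f) = ⊥ :=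
    congr(PrimeSpectrum.asIdeal $hy)
  have h2 : a ∈ ((X.toSpecΓ y : PrimeSpectrum Γ(X, ⊤)).asIdeal).comap (structureHom f) := by
    rw [Ideal.mem_comap, ha]
    exact zero_mem _
  rwa [h1, Ideal.mem_bot] at h2

/-- If the generic fibre of `X` over a normal domain `A` is geometrically integral, or geometrically
connected in characteristic zero, then a global section of `X` integral over `A` lies in `A`: its
minimal polynomial generates a finite extension of the fraction field over which the generic fibre
is defined. -/
theorem exists_structureHom_eq_of_isIntegralElem {A : Type u} [CommRing A] [IsDomain A]
    [IsIntegrallyClosed A] {X : Scheme.{u}} [IsIntegral X] (f : X ⟶ Spec (CommRingCat.of A))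
    [Surjective f] [QuasiCompact f]
    (h : (CharZero (FractionRing A) ∧ GeometricallyConnected (genericFiberToSpec f)) ∨
      GeometricallyIntegral (genericFiberToSpec f))
    (s : Γ(X, ⊤)) (hs : (structureHom f).IsIntegralElem s) : ∃ a, structureHom f a = s := by
  let K := FractionRing A
  let Y := pullback f (Spec.map (CommRingCat.ofHom (algebraMap A (FractionRing A))))
  let p₁ : Y ⟶ X := pullback.fst f (Spec.map (CommRingCat.ofHom (algebraMap A (FractionRing A))))
  have hcond : p₁ ≫ f = genericFiberToSpec f ≫
      Spec.map (CommRingCat.ofHom (algebraMap A K)) := pullback.condition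
  have hY : Nonempty Y := by
    have : Surjective (genericFiberToSpec f) := by unfold genericFiberToSpec; infer_instance
    obtain ⟨y, _⟩ := (genericFiberToSpec f).surjective (⊥ : PrimeSpectrum K)
    exact ⟨y⟩
  have hYc : CompactSpace Y := by
    have : QuasiCompact (genericFiberToSpec f) := by unfold genericFiberToSpec; infer_instance
    exact QuasiCompact.compactSpace_of_compactSpace (genericFiberToSpec f)
  algebraize [structureHom f]
  have : FaithfulSMul A Γ(X, ⊤) :=
    (faithfulSMul_iff_algebraMap_injective _ _).mpr (structureHom_injective f)
  have hs' : _root_.IsIntegral A s := hs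
  have hirr : Irreducible ((minpoly A s).map (algebraMap A K)) :=
    ((minpoly.monic hs').irreducible_iff_irreducible_map_fraction_map (K := K)).mp
      (minpoly.irreducible hs')
  have : Fact (Irreducible ((minpoly A s).map (algebraMap A K))) := ⟨hirr⟩
  let M := AdjoinRoot ((minpoly A s).map (algebraMap A K))
  have : FiniteDimensional K M :=
    (AdjoinRoot.powerBasis hirr.ne_zero).finite
  have hring : (structureHom (genericFiberToSpec f)).comp (algebraMap A K) =
      p₁.appTop.hom.comp (structureHom f) := by
    rw [← structureHom_comp, hcond, structureHom_comp_specMap]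
  have hroot : ((minpoly A s).map (algebraMap A K)).eval₂ (structureHom (genericFiberToSpec f))
      (p₁.appTop.hom s) = 0 := by
    rw [Polynomial.eval₂_map, hring, ← Polynomial.hom_eval₂]
    have : Polynomial.eval₂ (structureHom f) s (minpoly A s) = 0 := minpoly.aeval A s
    rw [this, map_zero]
  let φ : M →+* Γ(Y, ⊤) := AdjoinRoot.lift (structureHom (genericFiberToSpec f))
    (p₁.appTop.hom s) hroot
  have hφ : φ.comp (algebraMap K M) = structureHom (genericFiberToSpec f) := by
    ext x
    exact AdjoinRoot.lift_of hroot
  let q : Y ⟶ Spec (.of M) := Y.toSpecΓ ≫ Spec.map (CommRingCat.ofHom φ)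
  have hq : q ≫ Spec.map (CommRingCat.ofHom (algebraMap K M)) = genericFiberToSpec f := by
    rw [Category.assoc, ← Spec.map_comp, ← CommRingCat.ofHom_comp, hφ, toSpecΓ_structureHom]
  have hrank := finrank_eq_one_of_geometrically (genericFiberToSpec f) q hq h
  have hdeg : (minpoly A s).natDegree = 1 := by
    rw [← hrank, (AdjoinRoot.powerBasis hirr.ne_zero).finrank, AdjoinRoot.powerBasis_dim,
      (minpoly.monic hs').natDegree_map]
  have heval := minpoly.aeval A s
  rw [(minpoly.monic hs').eq_X_add_C hdeg, map_add, Polynomial.aeval_X, Polynomial.aeval_C] at heval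
  refine ⟨-(minpoly A s).coeff 0, ?_⟩
  rw [map_neg, eq_comm, eq_neg_iff_add_eq_zero]
  exact heval

end GlobalSections

/-! ### Finiteness of projective schemes -/

section ProjectiveFinite

attribute [local instance] MvPolynomial.gradedAlgebra

theorem isProper_projectiveSpaceToSpec (A : Type u) [CommRing A] (n : ℕ) :
    IsProper (projectiveSpaceToSpec A n) := by
  let 𝒜 := MvPolynomial.homogeneousSubmodule (Fin (n + 1)) A
  have hsurj : Function.Surjective (algebraMap A (𝒜 0)) := by
    rintro ⟨p, hp⟩
    have hp' : p ∈ (1 : Submodule A (MvPolynomial (Fin (n + 1)) A)) :=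
      (MvPolynomial.homogeneousSubmodule_zero (σ := Fin (n + 1)) (R := A)) ▸ hp
    obtain ⟨a, ha⟩ := Submodule.mem_one.mp hp'
    exact ⟨a, Subtype.ext ha⟩
  have : IsClosedImmersion (Spec.map (CommRingCat.ofHom (algebraMap A (𝒜 0)))) :=
    IsClosedImmersion.spec_of_surjective _ hsurj
  have : Algebra.FiniteType (𝒜 0) (MvPolynomial (Fin (n + 1)) A) :=
    @Algebra.FiniteType.of_restrictScalars_finiteType A (𝒜 0) (MvPolynomial (Fin (n + 1)) A)
      _ _ _ _ _ _ (IsScalarTower.of_algebraMap_eq fun _ ↦ rfl) inferInstance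
  have : IsProper (Proj.toSpecZero 𝒜) := inferInstance
  exact MorphismProperty.comp_mem @IsProper (Proj.toSpecZero 𝒜)
    (Spec.map (CommRingCat.ofHom (algebraMap A (𝒜 0)))) this inferInstance

theorem isProper_of_isProjectiveOver {A : Type u} [CommRing A] {X : Scheme.{u}}
    (f : X ⟶ Spec (CommRingCat.of A)) [IsProjectiveOver f] : IsProper f := by
  obtain ⟨n, i, _, rfl⟩ := IsProjectiveOver.exists_closedImmersion (f := f)
  have := isProper_projectiveSpaceToSpec A n
  infer_instance

theorem isNoetherian_of_isProjectiveOver {A : Type u} [CommRing A] [IsNoetherianRing A]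
    {X : Scheme.{u}} (f : X ⟶ Spec (CommRingCat.of A)) [IsProjectiveOver f] : IsNoetherian X := by
  have := isProper_of_isProjectiveOver f
  have : CompactSpace X := QuasiCompact.compactSpace_of_compactSpace f
  exact { __ := LocallyOfFiniteType.isLocallyNoetherian f }

theorem isSeparated_of_isProjectiveOver {A : Type u} [CommRing A]
    {X : Scheme.{u}} (f : X ⟶ Spec (CommRingCat.of A)) [IsProjectiveOver f] : X.IsSeparated := by
  have := isProper_of_isProjectiveOver f
  have : IsSeparated (f ≫ terminal.from _) := inferInstance
  exact ⟨by rwa [terminal.comp_from] at this⟩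

end ProjectiveFinite

/-! ### Restriction of `Proj` to a generic point -/

section ChartEval

open HomogeneousLocalization

variable {A R : Type u} [CommRing A] [CommRing R] [Algebra A R]
  {𝒜 : ℕ → Submodule A R} [GradedAlgebra 𝒜]

/-- Under `Γ(D₊(r)) = R_(r)`, the two descriptions of the chart `D₊(r)` of `Proj` agree. -/
theorem specMap_awayToSection_awayι {r : R} {d : ℕ} (hr : r ∈ 𝒜 d) (hd : 0 < d) :
    Spec.map (Proj.awayToSection 𝒜 r) ≫ Proj.awayι 𝒜 r hr hd =
      (Proj.isAffineOpen_basicOpen 𝒜 r hr hd).fromSpec := by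
  rw [IsAffineOpen.fromSpec, Iso.eq_inv_comp, ← Proj.basicOpenIsoSpec_inv_ι,
    IsAffineOpen.isoSpec_hom, ← Category.assoc, ← Category.assoc, Category.assoc _ _ (Iso.inv _)]
  have : (Proj.basicOpen 𝒜 r).toSpecΓ ≫ Spec.map (Proj.awayToSection 𝒜 r) =
    (Proj.basicOpenIsoSpec 𝒜 r hr hd).hom := (Proj.basicOpenIsoSpec_hom ..).symm
  rw [reassoc_of% this, Iso.hom_inv_id, Category.id_comp]

/-- The map from the coordinate ring of `D₊(r)` to the function field of `X` induced by a morphism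
`i : X ⟶ Proj 𝒜` sending the generic point into `D₊(r)`. -/
noncomputable def genericEval {X : Scheme.{u}} [IrreducibleSpace X] (i : X ⟶ Proj 𝒜) (r : R)
    (h : genericPoint X ∈ i ⁻¹ᵁ Proj.basicOpen 𝒜 r) : Away 𝒜 r →+* X.functionField :=
  (Proj.awayToSection 𝒜 r ≫ i.app (Proj.basicOpen 𝒜 r) ≫
    X.presheaf.germ _ (genericPoint X) h).hom

theorem specMap_genericEval {X : Scheme.{u}} [IrreducibleSpace X] (i : X ⟶ Proj 𝒜) [IsAffineHom i]
    {r : R} {d : ℕ} (hr : r ∈ 𝒜 d) (hd : 0 < d) (h : genericPoint X ∈ i ⁻¹ᵁ Proj.basicOpen 𝒜 r) :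
    Spec.map (CommRingCat.ofHom (genericEval i r h)) ≫ Proj.awayι 𝒜 r hr hd =
      X.fromSpecStalk (genericPoint X) ≫ i := by
  have hU := Proj.isAffineOpen_basicOpen 𝒜 r hr hd
  rw [genericEval, CommRingCat.ofHom_hom, Spec.map_comp, Spec.map_comp, Category.assoc,
    Category.assoc, specMap_awayToSection_awayι, Scheme.Hom.app_eq_appLE,
    IsAffineOpen.SpecMap_appLE_fromSpec i hU (hU.preimage i),
    ← (hU.preimage i).fromSpecStalk_eq_fromSpecStalk h, IsAffineOpen.fromSpecStalk, Category.assoc]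

/-- A point of a chart of `Proj` over the function field which gives the image of the generic point
is `genericEval`. -/
theorem exists_genericEval_eq {X : Scheme.{u}} [IrreducibleSpace X] (i : X ⟶ Proj 𝒜)
    [IsAffineHom i] {r : R} {d : ℕ} (hr : r ∈ 𝒜 d) (hd : 0 < d)
    (χ : Away 𝒜 r →+* X.functionField)
    (hχ : Spec.map (CommRingCat.ofHom χ) ≫ Proj.awayι 𝒜 r hr hd =
      X.fromSpecStalk (genericPoint X) ≫ i) :
    ∃ h : genericPoint X ∈ i ⁻¹ᵁ Proj.basicOpen 𝒜 r, genericEval i r h = χ := by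
  have h : genericPoint X ∈ i ⁻¹ᵁ Proj.basicOpen 𝒜 r := by
    have h1 : Proj.awayι 𝒜 r hr hd (Spec.map (CommRingCat.ofHom χ)
        (IsLocalRing.closedPoint X.functionField)) = i (X.fromSpecStalk (genericPoint X)
        (IsLocalRing.closedPoint X.functionField)) :=
      congr($hχ (IsLocalRing.closedPoint X.functionField))
    rw [Scheme.fromSpecStalk_closedPoint] at h1
    change i (genericPoint X) ∈ Proj.basicOpen 𝒜 r
    rw [← h1, ← Proj.opensRange_awayι 𝒜 r hr hd]
    exact ⟨_, rfl⟩
  refine ⟨h, ?_⟩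
  rw [← specMap_genericEval i hr hd h, cancel_mono, eq_comm] at hχ
  exact congr(($(Spec.map_injective hχ)).hom)

/-- For a closed immersion `i`, the image of `genericEval` is the ring of sections over the
preimage of `D₊(r)`. -/
theorem range_genericEval {X : Scheme.{u}} [IrreducibleSpace X] (i : X ⟶ Proj 𝒜)
    [IsClosedImmersion i] {r : R} {d : ℕ} (hr : r ∈ 𝒜 d) (hd : 0 < d)
    (h : genericPoint X ∈ i ⁻¹ᵁ Proj.basicOpen 𝒜 r) (g : X.functionField) :
    (∃ z, genericEval i r h z = g) ↔
      ∃ s, X.presheaf.germ (i ⁻¹ᵁ Proj.basicOpen 𝒜 r) (genericPoint X) h s = g := by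
  constructor
  · rintro ⟨z, rfl⟩
    exact ⟨_, rfl⟩
  · rintro ⟨s, rfl⟩
    obtain ⟨t, rfl⟩ := i.app_surjective _ (Proj.isAffineOpen_basicOpen 𝒜 r hr hd) s
    refine ⟨(Proj.basicOpenIsoAway 𝒜 r hr hd).inv t, ?_⟩
    have : (Proj.awayToSection 𝒜 r) ((Proj.basicOpenIsoAway 𝒜 r hr hd).inv t) = t := by
      rw [← Proj.basicOpenIsoAway_hom 𝒜 r hr hd, ← CommRingCat.comp_apply, Iso.inv_hom_id]
      rfl
    change X.presheaf.germ _ _ _ (i.app _ (Proj.awayToSection 𝒜 r _)) = _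
    rw [this]

end ChartEval

/-! ### Homogeneous coordinates in the function field -/

section Coordinates

open HomogeneousLocalization MvPolynomial

attribute [local instance] MvPolynomial.gradedAlgebra

theorem iSup_basicOpen_X_eq_top (A : Type u) [CommRing A] (σ : Type) :
    ⨆ j, Proj.basicOpen (homogeneousSubmodule σ A) (X j : MvPolynomial σ A) = ⊤ := by
  refine Proj.iSup_basicOpen_eq_top' _ _ (fun j ↦ ⟨1, isHomogeneous_X A j⟩) ?_
  have h := MvPolynomial.adjoin_range_X (R := A) (σ := σ)
  rw [eq_top_iff] at h ⊢
  intro p _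
  have hp := h (Algebra.mem_top (x := p))
  induction hp using Algebra.adjoin_induction with
  | mem x hx => exact Algebra.subset_adjoin hx
  | algebraMap a =>
    exact Subalgebra.algebraMap_mem _ (algebraMap A (homogeneousSubmodule σ A 0) a)
  | add x y _ _ hx hy => exact add_mem (hx trivial) (hy trivial)
  | mul x y _ _ hx hy => exact mul_mem (hx trivial) (hy trivial)

/-- An irreducible closed subscheme of projective space has homogeneous coordinates in its function
field `F`: they span a submodule `V` of `F` whose chart algebras are the rings of sections over
the standard affine charts. -/
theorem exists_coordinates {A : Type u} [CommRing A] {σ : Type} {Y : Scheme.{u}} [IsIntegral Y]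
    (i : Y ⟶ Proj (homogeneousSubmodule σ A)) [IsClosedImmersion i] [Algebra A Y.functionField]
    (halg : Spec.map (CommRingCat.ofHom (algebraMap A Y.functionField)) =
      Y.fromSpecStalk (genericPoint Y) ≫ i ≫ projToSpec A (homogeneousSubmodule σ A)) :
    ∃ c : σ → Y.functionField, 1 ∈ Submodule.span A (Set.range c) ∧
      ∀ j, (genericPoint Y ∈ i ⁻¹ᵁ Proj.basicOpen _ (X j : MvPolynomial σ A) ↔ c j ≠ 0) ∧
        ∀ (h : genericPoint Y ∈ i ⁻¹ᵁ Proj.basicOpen _ (X j : MvPolynomial σ A)) g,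
          (∃ s, Y.presheaf.germ _ (genericPoint Y) h s = g) ↔
            g ∈ chartAlgebra (Submodule.span A (Set.range c)) (c j)
              (Submodule.subset_span (Set.mem_range_self j)) := by
  let 𝒜 := homogeneousSubmodule σ A
  obtain ⟨i₀, hi₀⟩ : ∃ i₀, genericPoint Y ∈ i ⁻¹ᵁ Proj.basicOpen 𝒜 (X i₀ : MvPolynomial σ A) := by
    have : i (genericPoint Y) ∈ ⨆ j, Proj.basicOpen 𝒜 (X j : MvPolynomial σ A) := by
      rw [iSup_basicOpen_X_eq_top]; trivial
    exact ⟨_, (TopologicalSpace.Opens.mem_iSup.mp this).choose_spec⟩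
  have hX (j : σ) : (X j : MvPolynomial σ A) ∈ 𝒜 1 := isHomogeneous_X A j
  let χ := genericEval i (X i₀ : MvPolynomial σ A) hi₀
  have hχ := specMap_genericEval i (hX i₀) one_pos hi₀
  let c : σ → Y.functionField := fun j ↦ χ (awayCoord A i₀ j)
  have hc1 : c i₀ = 1 := by
    change χ _ = _
    rw [awayCoord_self, map_one]
  let ρ : MvPolynomial σ A →+* Y.functionField := (aeval c : MvPolynomial σ A →ₐ[A] _).toRingHom
  have hρ (j : σ) : ρ (X j) = c j := aeval_X c j
  have hρ0 : ρ (X i₀) ≠ 0 := by rw [hρ, hc1]; exact one_ne_zero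
  have hχA (a : A) : χ (fromZeroRingHom _ _ (algebraMap A (𝒜 0) a)) =
      algebraMap A Y.functionField a := by
    rw [projToSpec, ← reassoc_of% hχ, Proj.awayι_toSpecZero_assoc, ← Spec.map_comp,
      ← Spec.map_comp] at halg
    exact (congr(($(Spec.map_injective halg)).hom a)).symm
  have hχρ : χ = awayEval 𝒜 ρ (X i₀) hρ0 := eq_awayEval_aeval χ hχA (fun _ ↦ rfl) hρ0
  have hgen (j : σ) (hj : ρ (X j) ≠ 0) :
      ∃ h, genericEval i (X j : MvPolynomial σ A) h = awayEval 𝒜 ρ (X j) hj := by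
    apply exists_genericEval_eq i (hX j) one_pos
    rw [← hχ, specMap_awayEval_awayι ρ hj hρ0 (hX j) one_pos (hX i₀) one_pos]
    exact congr(Spec.map (CommRingCat.ofHom $hχρ) ≫ _).symm
  have hiff (j : σ) :
      genericPoint Y ∈ i ⁻¹ᵁ Proj.basicOpen _ (X j : MvPolynomial σ A) ↔ c j ≠ 0 := by
    refine ⟨fun h h0 ↦ ?_, fun h ↦ (hgen j (by rwa [hρ])).1⟩
    have h1 : Proj.awayι 𝒜 _ (hX i₀) one_pos (Spec.map (CommRingCat.ofHom χ)
        (IsLocalRing.closedPoint Y.functionField)) = i (Y.fromSpecStalk (genericPoint Y)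
        (IsLocalRing.closedPoint Y.functionField)) :=
      congr($hχ (IsLocalRing.closedPoint Y.functionField))
    rw [Scheme.fromSpecStalk_closedPoint] at h1
    have h2 : Spec.map (CommRingCat.ofHom χ) (IsLocalRing.closedPoint Y.functionField) ∈
        Proj.awayι 𝒜 _ (hX i₀) one_pos ⁻¹ᵁ Proj.basicOpen 𝒜 (X j) := by
      change Proj.awayι 𝒜 _ (hX i₀) one_pos _ ∈ Proj.basicOpen 𝒜 (X j)
      rw [h1]
      exact h
    rw [Proj.awayι_preimage_basicOpen 𝒜 (hX i₀) one_pos (hX j) one_pos] at h2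
    refine h2 ?_
    change χ _ ∈ IsLocalRing.maximalIdeal _
    have h3 : Away.isLocalizationElem (hX i₀) (hX j) = awayCoord A i₀ j := by
      ext
      rw [awayCoord, Away.val_mk, Away.val_mk]
      simp only [pow_one]
    rw [h3]
    change c j ∈ _
    rw [h0]
    exact zero_mem _
  refine ⟨c, hc1 ▸ Submodule.subset_span (Set.mem_range_self i₀), fun j ↦ ⟨hiff j, fun h g ↦ ?_⟩⟩
  have hj : ρ (X j) ≠ 0 := by rw [hρ]; exact (hiff j).mp h
  obtain ⟨h', he⟩ := hgen j hj
  rw [← range_genericEval i (hX j) one_pos h, he]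
  exact mem_range_awayEval_aeval (Submodule.subset_span (Set.mem_range_self j)) hj g

end Coordinates

/-! ### Chart algebras as rings of sections -/

section Comparison

/-- An injective ring homomorphism `φ : B → F` as an isomorphism onto its image `S`. -/
noncomputable def equivOfRange {A B F : Type*} [CommRing A] [CommRing B] [CommRing F] [Algebra A F]
    (φ : B →+* F) (hφ : Function.Injective φ) {S : Subalgebra A F}
    (hS : ∀ g, (∃ b, φ b = g) ↔ g ∈ S) : B ≃+* S :=
  RingEquiv.ofBijective (φ.codRestrict S fun b ↦ (hS _).mp ⟨b, rfl⟩)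
    ⟨fun _ _ h ↦ hφ congr(($h : F)), fun ⟨_, hg⟩ ↦ ((hS _).mpr hg).imp fun _ h ↦ Subtype.ext h⟩

/-- An injection of rings `φ : B → F` with image `S` identifies `Spec S` and `Spec B`. -/
theorem exists_isIso_specMap {A B F : Type u} [CommRing A] [CommRing B] [CommRing F] [Algebra A F]
    (φ : B →+* F) (hφ : Function.Injective φ) {S : Subalgebra A F}
    (hS : ∀ g, (∃ b, φ b = g) ↔ g ∈ S) :
    ∃ w : Spec (CommRingCat.of S) ⟶ Spec (CommRingCat.of B), IsIso w ∧
      Spec.map (CommRingCat.ofHom (algebraMap S F)) ≫ w = Spec.map (CommRingCat.ofHom φ) := by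
  refine ⟨Spec.map (equivOfRange φ hφ hS).toCommRingCatIso.hom, inferInstance, ?_⟩
  rw [← Spec.map_comp]
  rfl

theorem isDominant_specMap_algebraMap {A F : Type u} [CommRing A] [CommRing F] [Algebra A F]
    (S : Subalgebra A F) : IsDominant (Spec.map (CommRingCat.ofHom (algebraMap S F))) := by
  have h : Function.Injective (algebraMap S F) := Subtype.val_injective
  exact ⟨(PrimeSpectrum.denseRange_comap_iff_ker_le_nilRadical _).mpr
    (((RingHom.injective_iff_ker_eq_bot _).mp h).trans_le bot_le)⟩

variable {A : Type u} [CommRing A] {Y : Scheme.{u}} [IsIntegral Y] [Algebra A Y.functionField]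

/-- An affine open whose sections have image `S` in the function field is `Spec S`, compatibly with
the generic point. -/
theorem exists_chart_of_isAffineOpen {U : Y.Opens} (hU : IsAffineOpen U) (h : genericPoint Y ∈ U)
    {S : Subalgebra A Y.functionField}
    (hS : ∀ g, (∃ s, Y.presheaf.germ U (genericPoint Y) h s = g) ↔ g ∈ S) :
    ∃ u : Spec (CommRingCat.of S) ⟶ Y, ∃ _ : IsOpenImmersion u, u.opensRange = U ∧
      Spec.map (CommRingCat.ofHom (algebraMap S Y.functionField)) ≫ u =
        Y.fromSpecStalk (genericPoint Y) := by
  obtain ⟨w, _, hw⟩ := exists_isIso_specMap (Y.presheaf.germ U (genericPoint Y) h).hom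
    (germ_injective_of_isIntegral _ _ h) hS
  refine ⟨w ≫ hU.fromSpec, inferInstance, ?_, ?_⟩
  · rw [Scheme.Hom.opensRange_comp_of_isIso]
    exact hU.opensRange_fromSpec
  · rw [reassoc_of% hw, ← hU.fromSpecStalk_eq_fromSpecStalk h]
    rfl

/-- On a normal scheme, the image in the function field of the sections over an affine open is
integrally closed. -/
theorem mem_of_isIntegral_of_isAffineOpen [IsNormalScheme Y] {U : Y.Opens} (hU : IsAffineOpen U)
    (h : genericPoint Y ∈ U) {S : Subalgebra A Y.functionField}
    (hS : ∀ g, (∃ s, Y.presheaf.germ U (genericPoint Y) h s = g) ↔ g ∈ S) (g : Y.functionField)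
    (hg : _root_.IsIntegral S g) : g ∈ S := by
  have : Nonempty U := ⟨⟨_, h⟩⟩
  have := isIntegrallyClosed_of_isAffineOpen hU
  have := functionField_isFractionRing_of_isAffineOpen Y U hU
  let e : Γ(Y, U) ≃+* S := equivOfRange (Y.presheaf.germ U (genericPoint Y) h).hom
    (germ_injective_of_isIntegral _ _ h) hS
  have he (x : S) : algebraMap Γ(Y, U) Y.functionField (e.symm x) = x :=
    congr(($(e.apply_symm_apply x) : Y.functionField))
  let : Algebra S Γ(Y, U) := e.symm.toRingHom.toAlgebra
  have : IsScalarTower S Γ(Y, U) Y.functionField := .of_algebraMap_eq fun x ↦ (he x).symm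
  obtain ⟨s, hs⟩ := IsIntegrallyClosed.isIntegral_iff.mp (hg.tower_top (A := Γ(Y, U)))
  exact (hS g).mp ⟨s, hs⟩

/-- Sections over the members of an open cover with the same image in the function field glue. -/
theorem exists_germ_top_eq {ι : Type*} {U : ι → Y.Opens} (hcov : ∀ y, ∃ j, y ∈ U j)
    (h : ∀ j, genericPoint Y ∈ U j) (g : Y.functionField)
    (hg : ∀ j, ∃ s, Y.presheaf.germ (U j) (genericPoint Y) (h j) s = g) :
    ∃ s, Y.presheaf.germ ⊤ (genericPoint Y) trivial s = g := by
  choose s hs using hg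
  obtain ⟨t, ht, -⟩ := Y.sheaf.existsUnique_gluing' U ⊤ (fun j ↦ homOfLE le_top)
    (fun y _ ↦ TopologicalSpace.Opens.mem_iSup.mpr (hcov y)) s fun i j ↦ by
      refine germ_injective_of_isIntegral Y (U := U i ⊓ U j) (genericPoint Y) ⟨h i, h j⟩ ?_
      have hres (k : ι) (l : U i ⊓ U j ⟶ U k) : Y.presheaf.germ (U i ⊓ U j) (genericPoint Y)
          ⟨h i, h j⟩ (Y.presheaf.map l.op (s k)) = g :=
        (TopCat.Presheaf.germ_res_apply ..).trans (hs k)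
      exact (hres i _).trans (hres j _).symm
  obtain ⟨j, -⟩ := hcov (genericPoint Y)
  refine ⟨t, ?_⟩
  rw [← hs j, ← ht j]
  exact (TopCat.Presheaf.germ_res_apply ..).symm

end Comparison

/-! ### The isomorphism with `Proj` of the Rees algebra -/

section Main

theorem specMap_germ_structureHom {A : Type u} [CommRing A] {Y : Scheme.{u}} (y : Y)
    (f : Y ⟶ Spec (CommRingCat.of A)) :
    Spec.map (CommRingCat.ofHom ((Y.presheaf.germ ⊤ y trivial).hom.comp (structureHom f))) =
      Y.fromSpecStalk y ≫ f := by
  rw [CommRingCat.ofHom_comp, Spec.map_comp, CommRingCat.ofHom_hom,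
    ← Scheme.fromSpecStalk_toSpecΓ, Category.assoc, toSpecΓ_structureHom]

/-- A separated integral scheme over `Spec A` covered by affine opens with coordinate rings the
chart algebras of `V = ∑ A cⱼ` is `Proj` of the Rees algebra of each power of `V`. -/
theorem exists_iso_proj_reesGrading {A : Type u} [CommRing A] {Y : Scheme.{u}} [IsIntegral Y]
    [Y.IsSeparated] (f : Y ⟶ Spec (CommRingCat.of A)) [Algebra A Y.functionField]
    (halg : Spec.map (CommRingCat.ofHom (algebraMap A Y.functionField)) =
      Y.fromSpecStalk (genericPoint Y) ≫ f) {ι : Type*} {c : ι → Y.functionField}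
    {V : Submodule A Y.functionField} (hV : Submodule.span A (Set.range c) = V)
    (hc : ∀ j, c j ∈ V) {U : ι → Y.Opens} (hU : ∀ j, IsAffineOpen (U j)) (hcov : ∀ y, ∃ j, y ∈ U j)
    (hUc : ∀ j, genericPoint Y ∈ U j ↔ c j ≠ 0)
    (hS : ∀ j h g, (∃ s, Y.presheaf.germ (U j) (genericPoint Y) h s = g) ↔
      g ∈ chartAlgebra V (c j) (hc j)) {d : ℕ} (hd : 0 < d) :
    ∃ e : Y ≅ Proj (reesGrading (V ^ d)), e.hom ≫ projToSpec A (reesGrading (V ^ d)) = f := by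
  have hcd (j : ι) : c j ^ d ∈ V ^ d := Submodule.pow_mem_pow V (hc j) d
  have hcd1 (j : ι) : c j ^ d ∈ (V ^ d) ^ 1 := by rw [pow_one]; exact hcd j
  let S (j : {j // c j ≠ 0}) : Subalgebra A Y.functionField := chartAlgebra V (c j) (hc j)
  let r (j : {j // c j ≠ 0}) : reesSubalgebra (V ^ d) := reesMonomial (V ^ d) 1 _ (hcd1 j)
  have hr (j) : r j ∈ reesGrading (V ^ d) 1 := reesMonomial_mem _
  have hr0 (j : {j // c j ≠ 0}) : reesEval (V ^ d) (r j) ≠ 0 := by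
    rw [reesEval_reesMonomial]
    exact pow_ne_zero _ j.2
  choose u hu hur hτu using fun j : {j // c j ≠ 0} ↦
    exists_chart_of_isAffineOpen (hU j) ((hUc j).mpr j.2) (S := S j) (hS j _)
  choose w hw hτw using fun j : {j // c j ≠ 0} ↦
    exists_isIso_specMap (awayEval (reesGrading (V ^ d)) (reesEval (V ^ d)) (r j) (hr0 j))
      (awayEval_reesEval_injective (hr j) (hr0 j)) (S := S j) fun g ↦
        (mem_range_awayEval_reesEval (hcd j) (pow_ne_zero _ j.2) (hcd1 j) (hr0 j) g).trans
          (mem_chartAlgebra_pow hd)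
  let v (j) : Spec (CommRingCat.of (S j)) ⟶ Proj (reesGrading (V ^ d)) :=
    w j ≫ Proj.awayι _ (r j) (hr j) one_pos
  let τ (j) : Spec Y.functionField ⟶ Spec (CommRingCat.of (S j)) :=
    Spec.map (CommRingCat.ofHom (algebraMap (S j) Y.functionField))
  have hτv (j) : τ j ≫ v j = Spec.map (CommRingCat.ofHom
      (awayEval (reesGrading (V ^ d)) (reesEval (V ^ d)) (r j) (hr0 j))) ≫
      Proj.awayι _ (r j) (hr j) one_pos := by
    rw [← hτw j, Category.assoc]
    rfl
  have hτ (j) : IsDominant (τ j) := isDominant_specMap_algebraMap (S j)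
  have huc (y : Y) : ∃ j, y ∈ Set.range (u j) := by
    obtain ⟨j, hj⟩ := hcov y
    have hg : genericPoint Y ∈ U j :=
      ((genericPoint_spec Y).mem_open_set_iff (U j).isOpen).mpr ⟨y, trivial, hj⟩
    let j' : {j // c j ≠ 0} := ⟨j, (hUc j).mp hg⟩
    exact ⟨j', show y ∈ (u j').opensRange by rw [hur]; exact hj⟩
  have hvc (y : Proj (reesGrading (V ^ d))) : ∃ j, y ∈ Set.range (v j) := by
    have hy : y ∈ (⊤ : (Proj (reesGrading (V ^ d))).Opens) := trivial
    rw [← iSup_basicOpen_reesGrading_eq_top hV hd hcd1, TopologicalSpace.Opens.mem_iSup] at hy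
    obtain ⟨j, hj⟩ := hy
    refine ⟨j, show y ∈ (v j).opensRange from ?_⟩
    rw [Scheme.Hom.opensRange_comp_of_isIso, Proj.opensRange_awayι]
    exact hj
  obtain ⟨e, he⟩ := exists_iso_of_charts (fun j ↦ Spec (CommRingCat.of (S j))) u v huc hvc τ
    (fun i j ↦ (hτu i).trans (hτu j).symm) fun i j ↦ by
      rw [hτv, hτv]
      exact specMap_awayEval_awayι _ _ _ _ _ _ _
  refine ⟨e, hom_ext_of_charts (fun j ↦ Spec (CommRingCat.of (S j))) u huc fun j ↦ ?_⟩
  refine ext_of_isDominant (τ j) ?_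
  have h1 : τ j ≫ u j = Y.fromSpecStalk (genericPoint Y) := hτu j
  rw [reassoc_of% (he j), reassoc_of% (hτv j), reassoc_of% h1, ← halg, projToSpec,
    Proj.awayι_toSpecZero_assoc, ← Spec.map_comp, ← Spec.map_comp]
  congr 1
  ext a
  refine (awayEval_fromZeroRingHom _ (hr0 j) _).trans ?_
  change Polynomial.eval 1 (Polynomial.C (algebraMap A Y.functionField a)) = _
  rw [Polynomial.eval_C]
  rfl

end Main

end NormalProj

theorem lemma5p2 (A : Type u) [CommRing A] [IsDomain A] [IsNoetherianRing A] [IsLocalRing A]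
    [IsIntegrallyClosed A] (X : Scheme.{u}) (f : X ⟶ Spec (CommRingCat.of A))
    [NormalProj.IsNormalScheme X] [ConnectedSpace X] [NormalProj.IsProjectiveOver f]
    [Flat f] [Surjective f]
    (h : (CharZero (FractionRing A) ∧ GeometricallyConnected (NormalProj.genericFiberToSpec f)) ∨
      GeometricallyIntegral (NormalProj.genericFiberToSpec f)) :
    ∃ (R : Type u) (_ : CommRing R) (_ : Algebra A R) (𝒜 : ℕ → Submodule A R)
      (_ : GradedAlgebra 𝒜),
      IsDomain R ∧ IsIntegrallyClosed R ∧ NormalProj.IsStandardGraded 𝒜 ∧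
      Function.Bijective (algebraMap A (𝒜 0)) ∧
      ∃ e : X ≅ Proj 𝒜, e.hom ≫ NormalProj.projToSpec A 𝒜 = f := by
  open NormalProj in
  have : IsNoetherian X := isNoetherian_of_isProjectiveOver f
  have : X.IsSeparated := isSeparated_of_isProjectiveOver f
  have : IsProper f := isProper_of_isProjectiveOver f
  have : IsIntegral X := isIntegral_of_isNormalScheme X
  obtain ⟨n, i₀, hi₀, hif⟩ := IsProjectiveOver.exists_closedImmersion (f := f)
  let := MvPolynomial.gradedAlgebra (σ := Fin (n + 1)) (R := A)
  let i : X ⟶ Proj (MvPolynomial.homogeneousSubmodule (Fin (n + 1)) A) := i₀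
  have : IsClosedImmersion i := hi₀
  let φ : A →+* X.functionField :=
    (X.presheaf.germ ⊤ (genericPoint X) trivial).hom.comp (structureHom f)
  have hγ := germ_injective_of_isIntegral X (U := ⊤) (genericPoint X) trivial
  let : Algebra A X.functionField := φ.toAlgebra
  have halg : Spec.map (CommRingCat.ofHom (algebraMap A X.functionField)) =
    X.fromSpecStalk (genericPoint X) ≫ f := specMap_germ_structureHom _ f
  have hinj : Function.Injective (algebraMap A X.functionField) :=
    hγ.comp (structureHom_injective f)
  obtain ⟨c, h1, hUS⟩ := exists_coordinates i (halg.trans (congr(_ ≫ $hif.symm)))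
  set V := Submodule.span A (Set.range c) with hV
  have hc (j) : c j ∈ V := Submodule.subset_span (Set.mem_range_self j)
  let U (j : Fin (n + 1)) : X.Opens := i ⁻¹ᵁ Proj.basicOpen
    (MvPolynomial.homogeneousSubmodule (Fin (n + 1)) A) (MvPolynomial.X j)
  have hU (j) : IsAffineOpen (U j) :=
    (Proj.isAffineOpen_basicOpen _ _ (MvPolynomial.isHomogeneous_X A j) one_pos).preimage i
  have hcov (y : X) : ∃ j, y ∈ U j := by
    have hy : i y ∈ (⊤ : (Proj (MvPolynomial.homogeneousSubmodule (Fin (n + 1)) A)).Opens) :=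
      trivial
    rw [← iSup_basicOpen_X_eq_top A (Fin (n + 1)), TopologicalSpace.Opens.mem_iSup] at hy
    exact hy
  have hUc (j) : genericPoint X ∈ U j ↔ c j ≠ 0 := (hUS j).1
  have hS (j) (hj : genericPoint X ∈ U j) := (hUS j).2 hj
  have hcov' (y : X) : ∃ j : {j // c j ≠ 0}, y ∈ U j := by
    obtain ⟨j, hj⟩ := hcov y
    exact ⟨⟨j, (hUc j).mp (((genericPoint_spec X).mem_open_set_iff (U j).isOpen).mpr
      ⟨y, trivial, hj⟩)⟩, hj⟩
  -- an element of all the chart algebras is a global section integral over `A`, so lies in `A`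
  have h0 (g : X.functionField) (hg : ∀ j, c j ≠ 0 → g ∈ chartAlgebra V (c j) (hc j)) :
      g ∈ (1 : Submodule A X.functionField) := by
    obtain ⟨s, rfl⟩ := exists_germ_top_eq hcov' (fun j ↦ (hUc j).mpr j.2) g fun j ↦
      (hS j _ g).mpr (hg j j.2)
    obtain ⟨p, hp, hps⟩ := isIntegral_of_forall_mem_chartAlgebra hV.symm hc h1 hg
    obtain ⟨a, ha⟩ := exists_structureHom_eq_of_isIntegralElem f h s ⟨p, hp,
      hγ ((Polynomial.hom_eval₂ ..).trans (hps.trans (map_zero _).symm))⟩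
    exact Submodule.mem_one.mpr ⟨a, congr(X.presheaf.germ ⊤ (genericPoint X) trivial $ha)⟩
  obtain ⟨d, hd, hsat⟩ := exists_pos_forall_mem_pow hV.symm hc h1 h0
  have hfg : (V ^ d).FG := (Submodule.fg_span (Set.finite_range c)).pow d
  refine ⟨reesSubalgebra (V ^ d), inferInstance, inferInstance, reesGrading (V ^ d), inferInstance,
    inferInstance, ?_, isStandardGraded_reesGrading hinj hfg,
    bijective_algebraMap_reesGrading_zero hinj _,
    exists_iso_proj_reesGrading f halg hV.symm hc hU hcov hUc hS hd⟩
  refine isIntegrallyClosed_reesSubalgebra (fun j : {j // c j ≠ 0} ↦ c j ^ d)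
    (fun j ↦ Submodule.pow_mem_pow V (hc j) d) (fun j ↦ pow_ne_zero _ j.2) (fun j g hg ↦ ?_)
    fun k g hg ↦ ?_
  · exact mem_of_isIntegral_of_isAffineOpen (hU j) ((hUc j).mpr j.2)
      (fun g ↦ (hS j _ g).trans (mem_chartAlgebra_pow hd).symm) g hg
  · rw [← pow_mul]
    refine hsat k g fun j hj ↦ ?_
    obtain ⟨a, ha, hga⟩ := hg ⟨j, hj⟩
    exact ⟨a, (mem_chartAlgebra_pow hd).mp ha, by rw [hga, pow_mul]⟩
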